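/- **Types.** Pure types are the closed types over $\tau ::= \mathbf{1} \mid \tau\times\tau \mid \tau\to\tau \mid \tau+\tau \mid \alpha \mid \mathsf{rec}\,\alpha.\tau$. They are interpreted as cpos (posets with a least element and all directed suprema): $[\![\mathbf 1]\!]=\{\bot\le\top\}$; $[\![\tau\times\sigma]\!]$ is the product with the componentwise order; $[\![\sigma\to\tau]\!]$ is the set of Scott-continuous functions with the pointwise order; $[\![\tau+\sigma]\!]$ is the disjoint union augmented with a new least element, with injections $\mathrm{in}_1,\mathrm{in}_2$; type expressions with free variables denote functors on cpos and embedding-projection pairs, and $[\![\mathsf{rec}\,\alpha.\tau]\!]$ is the bilimit of the $\omega$-chain of embedding-projection pairs obtained by iterating $[\![\tau]\!]$ in $\alpha$ from the one-point cpo, with the canonical map $\mathrm{unfold}:[\![\mathsf{rec}\,\alpha.\tau]\!]\to[\![\tau[\mathsf{rec}\,\alpha.\tau/\alpha]]\!]$. **Formulae.** Iteration terms are $t::=\iota\mid 0\mid t+1$, with $\iota$ an iteration variable. For $s\in\{\pm,+,-\}$ (with $-\pm=\pm$, $-+=-$, $--=+$), a pure type $\tau$ and a context $\Gamma$ of typed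 fixpoint variables, the set $\mathcal L^s(\Gamma;\tau)$ is defined inductively as follows. * $\mathrm{True},\mathrm{False}\in\mathcal L^s(\Gamma;\tau)$, and $\mathcal L^s(\Gamma;\tau)$ is closed under $\wedge$ and $\vee$; $\langle()\rangle\in\mathcal L^s(\Gamma;\mathbf 1)$; $X\in\mathcal L^s(\Gamma;\tau)$ if $(X:\tau)\in\Gamma$. * If $\varphi\in\mathcal L^s(\Gamma;\tau_i)$ then $\langle\pi_i\rangle\varphi\in\mathcal L^s(\Gamma;\tau_1\times\tau_2)$ and $\langle \mathrm{in}_i\rangle\varphi\in\mathcal L^s(\Gamma;\tau_1+\tau_2)$ ($i=1,2$); if $\varphi\in\mathcal L^s(\Gamma;\tau[\mathsf{rec}\,\alpha.\tau/\alpha])$ then $\langle\mathsf{fold}\rangle\varphi\in\mathcal L^s(\Gamma;\mathsf{rec}\,\alpha.\tau)$. * If $\varphi\in\mathcal L^s(\Gamma,X{:}\tau;\tau)$ and $t$ is an iteration term, then $(\mu^tX)\varphi,(\nu^tX)\varphi\in\mathcal L^s(\Gamma;\tau)$. * If $\varphi\in\mathcal L^+(\Gamma;\tau)$ and $\iota\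 \mathrm{Pos}\ \varphi$ then $(\exists\iota)\varphi\in\mathcal L^+(\Gamma;\tau)$; if $\varphi\in\mathcal L^-(\Gamma;\tau)$ and $\iota\ \mathrm{Neg}\ \varphi$ then $(\forall\iota)\varphi\in\mathcal L^-(\Gamma;\tau)$. * If $\psi\in\mathcal L^{-s}(\,;\sigma)$ and $\varphi\in\mathcal L^s(\,;\tau)$ have no free fixpoint variables, then $(\psi\Rightarrow\varphi)\in\mathcal L^s(\Gamma;\sigma\to\tau)$. The predicates $\mathrm{Pos}$ and $\mathrm{Neg}$ are defined by mutual induction. Both hold of $(\iota,\varphi)$ if $\iota$ is not free in $\varphi$, and both are preserved by $\wedge$, $\vee$ and the modalities $\langle\pi_i\rangle$, $\langle\mathrm{in}_i\rangle$, $\langle\mathsf{fold}\rangle$; $\iota\ \mathrm{Pos}\ (\psi\Rightarrow\varphi)$ if $\iota\ \mathrm{Neg}\ \psi$ and $\iota\ \mathrm{Pos}\ \varphi$, and dually for $\mathrm{Neg}$; $\iota\ \mathrm{Pos}\ \varphi$ implies $\iota\ \mathrm{Pos}\ (\exists\kappa)\varphi$, $\iota\ \mathrm{Pos}\ (\mu^tX)\varphi$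 and, if $\iota$ is not free in $t$, $\iota\ \mathrm{Pos}\ (\nu^tX)\varphi$; dually, $\iota\ \mathrm{Neg}\ \varphi$ implies $\iota\ \mathrm{Neg}\ (\forall\kappa)\varphi$, $\iota\ \mathrm{Neg}\ (\nu^tX)\varphi$ and, if $\iota$ is not free in $t$, $\iota\ \mathrm{Neg}\ (\mu^tX)\varphi$. **Semantics.** Let $v$ be a valuation of the fixpoint variables $X:\tau$ of $\Gamma$ by subsets of $[\![\tau]\!]$ and of the iteration variables by natural numbers. For $\varphi$ of type $\tau$, the set $[\![\varphi]\!]v\subseteq[\![\tau]\!]$ is defined by: $\mathrm{True},\mathrm{False},\wedge,\vee$ denote the whole set, $\emptyset$, $\cap$, $\cup$; $[\![X]\!]v=v(X)$; $[\![\langle()\rangle]\!]v=\{\top\}$; $[\![\langle\pi_i\rangle\varphi]\!]v=\pi_i^{-1}([\![\varphi]\!]v)$; $[\![\langle\mathrm{in}_i\rangle\varphi]\!]v=\mathrm{in}_i([\![\varphi]\!]v)$ (direct image); $[\![\langle\mathsf{fold}\rangle\varphi]\!]v=\mathrm{unfold}^{-1}([\![\varphi]\!]v)$; $[\![\psi\Rightarrow\varphi]\!]v=\{f\mid\forall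 x\in[\![\psi]\!]v,\ f(x)\in[\![\varphi]\!]v\}$; $[\![(\exists\iota)\varphi]\!]v=\bigcup_{n\in\mathbb N}[\![\varphi]\!]v[n/\iota]$; $[\![(\forall\iota)\varphi]\!]v=\bigcap_{n\in\mathbb N}[\![\varphi]\!]v[n/\iota]$; and $[\![(\mu^tX)\varphi]\!]v$, resp. $[\![(\nu^tX)\varphi]\!]v$, is the $[\![t]\!]v$-fold iterate of $S\mapsto[\![\varphi]\!]v[S/X]$ applied to $\emptyset$, resp. to $[\![\tau]\!]$. **Proposition.** For every pure type $\tau$, the cpo $[\![\tau]\!]$ is a Scott domain (a bounded-complete algebraic cpo). Moreover, for every formula $\varphi$ of type $\tau$ without free fixpoint variables and every valuation $v$: 1. if $\varphi\in\mathcal L^+(\tau)$, then $[\![\varphi]\!]v$ is open in the Scott topology of $[\![\tau]\!]$; 2. if $\varphi\in\mathcal L^-(\tau)$, then $[\![\varphi]\!]v$ is compact in the Scott topology and saturated (upward-closed); 3. in particular, if $\varphi\in\mathcal L^\pm(\tau)$, then $[\![\varphi]\!]v$ is compact and open in the Scott topology. -/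

import Mathlib

open CategoryTheory

namespace PolarLogic

/-! ## Complete partial orders and embedding-projection pairs -/

/-- A cpo: a poset with a least element and suprema of all (non-empty) directed subsets. -/
structure Cpo : Type 1 where
  carrier : Type
  [order : PartialOrder carrier]
  exists_bot : ∃ b : carrier, ∀ x, b ≤ x
  exists_lub : ∀ D : Set carrier, D.Nonempty → DirectedOn (· ≤ ·) D → ∃ a, IsLUB D a

instance : CoeSort Cpo Type := ⟨Cpo.carrier⟩

attribute [instance] Cpo.order

/-- A cpo is a Scott domain when it is algebraic (every element is the directed supremum of the
finite elements below it) and bounded-complete. -/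
structure IsScottDomain (X : Cpo) : Prop where
  approx_nonempty : ∀ x : X, {d : X | IsCompactElement d ∧ d ≤ x}.Nonempty
  approx_directed : ∀ x : X, DirectedOn (· ≤ ·) {d : X | IsCompactElement d ∧ d ≤ x}
  approx_isLUB : ∀ x : X, IsLUB {d : X | IsCompactElement d ∧ d ≤ x} x
  bounded_complete : ∀ x y : X, BddAbove {x, y} → ∃ z, IsLUB {x, y} z

/-- The Scott-open sets. -/
def ScottOpen (X : Cpo) (U : Set X) : Prop :=
  @IsOpen X (Topology.scott X Set.univ) U

/-- The sets which are compact for the Scott topology. -/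
def ScottCompact (X : Cpo) (Q : Set X) : Prop :=
  @IsCompact X (Topology.scott X Set.univ) Q

/-- The sets which are compact for the Scott topology and saturated (upward-closed). -/
def CompactSaturated (X : Cpo) (Q : Set X) : Prop :=
  ScottCompact X Q ∧ IsUpperSet Q

/-- The sets which are compact and open for the Scott topology. -/
def CompactOpen (X : Cpo) (K : Set X) : Prop :=
  ScottCompact X K ∧ ScottOpen X K

/-- Embedding-projection pairs of Scott-continuous functions. -/
structure EP (X Y : Cpo) : Type where
  emb : X → Y
  proj : Y → X
  emb_cont : ScottContinuous emb
  proj_cont : ScottContinuous proj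
  proj_emb : ∀ x, proj (emb x) = x
  emb_proj : ∀ y, emb (proj y) ≤ y

/-- The projection determines the embedding. -/
theorem EP.ext_proj {X Y : Cpo} {f g : EP X Y} (h : ∀ y, f.proj y = g.proj y) : f = g := by
  have hp : f.proj = g.proj := funext h
  have he : f.emb = g.emb := by
    funext x
    apply le_antisymm
    · have := f.emb_proj (g.emb x)
      rwa [h, g.proj_emb] at this
    · have := g.emb_proj (f.emb x)
      rwa [← h, f.proj_emb] at this
  cases f
  cases g
  cases hp
  cases he
  rfl

/-- The category of cpos, with embedding-projection pairs as morphisms. -/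
instance : Category Cpo where
  Hom := EP
  id X := ⟨fun x => x, fun x => x, ScottContinuous.id, ScottContinuous.id, fun _ => rfl,
    fun _ => le_rfl⟩
  comp f g := ⟨fun x => g.emb (f.emb x), fun z => f.proj (g.proj z),
    f.emb_cont.comp g.emb_cont, g.proj_cont.comp f.proj_cont,
    fun x => by rw [g.proj_emb, f.proj_emb],
    fun z => (g.emb_cont.monotone (f.emb_proj _)).trans (g.emb_proj z)⟩

theorem hom_ext {X Y : Cpo} {f g : X ⟶ Y} (h : ∀ y, EP.proj f y = EP.proj g y) : f = g :=
  EP.ext_proj h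

@[simp] theorem id_emb (X : Cpo) (x : X) : EP.emb (𝟙 X) x = x := rfl
@[simp] theorem id_proj (X : Cpo) (x : X) : EP.proj (𝟙 X) x = x := rfl
@[simp] theorem comp_emb {X Y Z : Cpo} (f : X ⟶ Y) (g : Y ⟶ Z) (x : X) :
    EP.emb (f ≫ g) x = EP.emb g (EP.emb f x) := rfl
@[simp] theorem comp_proj {X Y Z : Cpo} (f : X ⟶ Y) (g : Y ⟶ Z) (z : Z) :
    EP.proj (f ≫ g) z = EP.proj f (EP.proj g z) := rfl

theorem directedOn_image_of_monotone {α β : Type} [Preorder α] [Preorder β] {f : α → β}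
    (hf : Monotone f) {D : Set α} (hD : DirectedOn (· ≤ ·) D) :
    DirectedOn (· ≤ ·) (f '' D) := by
  rintro _ ⟨a, ha, rfl⟩ _ ⟨b, hb, rfl⟩
  obtain ⟨c, hc, hac, hbc⟩ := hD a ha b hb
  exact ⟨f c, ⟨c, hc, rfl⟩, hf hac, hf hbc⟩

/-! ## The one-point cpo, the two-point cpo and products -/

/-- The one-point cpo. -/
def oneCpo : Cpo where
  carrier := Unit
  exists_bot := ⟨(), fun _ => le_rfl⟩
  exists_lub _ _ _ := ⟨(), fun _ _ => le_rfl, fun _ _ => le_rfl⟩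

/-- The two-point cpo `{⊥ ≤ ⊤}`. -/
def twoCpo : Cpo where
  carrier := Prop
  exists_bot := ⟨⊥, fun _ => bot_le⟩
  exists_lub D _ _ := ⟨sSup D, isLUB_sSup D⟩

/-- The one-point cpo is initial among cpos and embedding-projection pairs. -/
noncomputable def fromOne (X : Cpo) : oneCpo ⟶ X where
  emb _ := X.exists_bot.choose
  proj _ := ()
  emb_cont := ScottContinuous.const _
  proj_cont := ScottContinuous.const _
  proj_emb _ := rfl
  emb_proj := X.exists_bot.choose_spec

theorem fromOne_eq {X : Cpo} (f g : oneCpo ⟶ X) : f = g := hom_ext fun _ => rfl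

/-- The product of two cpos, with the componentwise order. -/
def prodCpo (X Y : Cpo) : Cpo where
  carrier := X × Y
  exists_bot := by
    obtain ⟨a, ha⟩ := X.exists_bot
    obtain ⟨b, hb⟩ := Y.exists_bot
    exact ⟨(a, b), fun p => ⟨ha p.1, hb p.2⟩⟩
  exists_lub D hne hD := by
    obtain ⟨a, ha⟩ := X.exists_lub (Prod.fst '' D) (hne.image _)
      (directedOn_image_of_monotone monotone_fst hD)
    obtain ⟨b, hb⟩ := Y.exists_lub (Prod.snd '' D) (hne.image _)
      (directedOn_image_of_monotone monotone_snd hD)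
    exact ⟨(a, b), isLUB_prod.2 ⟨ha, hb⟩⟩

/-- The action of products on embedding-projection pairs. -/
def prodEP {X X' Y Y' : Cpo} (f : X ⟶ X') (g : Y ⟶ Y') : prodCpo X Y ⟶ prodCpo X' Y' where
  emb := Prod.map (EP.emb f) (EP.emb g)
  proj := Prod.map (EP.proj f) (EP.proj g)
  emb_cont := (EP.emb_cont f).prod (EP.emb_cont g)
  proj_cont := (EP.proj_cont f).prod (EP.proj_cont g)
  proj_emb p := Prod.ext (EP.proj_emb f p.1) (EP.proj_emb g p.2)
  emb_proj p := ⟨EP.emb_proj f p.1, EP.emb_proj g p.2⟩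

/-! ## Function spaces -/

theorem exists_pointwise_lub {X Y : Cpo} (D : Set {f : X → Y // ScottContinuous f})
    (hne : D.Nonempty) (hD : DirectedOn (· ≤ ·) D) :
    ∃ g : {f : X → Y // ScottContinuous f}, IsLUB D g ∧
      ∀ x, IsLUB ((fun f : {f : X → Y // ScottContinuous f} => f.1 x) '' D) (g.1 x) := by
  have h : ∀ x : X, ∃ a, IsLUB ((fun f : {f : X → Y // ScottContinuous f} => f.1 x) '' D) a :=
    fun x => Y.exists_lub _ (hne.image _)
      (directedOn_image_of_monotone (fun (f f' : {f : X → Y // ScottContinuous f}) hff => (show f.1 ≤ f'.1 from hff) x) hD)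
  choose g hg using h
  have hmono : Monotone g := fun x y hxy => (hg x).2 <| by
    rintro _ ⟨f, hf, rfl⟩
    exact (f.2.monotone hxy).trans ((hg y).1 ⟨f, hf, rfl⟩)
  have hc : ScottContinuous g := by
    intro d hd hdd a ha
    refine ⟨hmono.mem_upperBounds_image ha.1, fun b hb => (hg a).2 ?_⟩
    rintro _ ⟨f, hf, rfl⟩
    refine (f.2 hd hdd ha).2 ?_
    rintro _ ⟨x, hx, rfl⟩
    exact ((hg x).1 ⟨f, hf, rfl⟩).trans (hb ⟨x, hx, rfl⟩)
  refine ⟨⟨g, hc⟩, ⟨fun f hf x => (hg x).1 ⟨f, hf, rfl⟩, fun f hf x => (hg x).2 ?_⟩, hg⟩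
  rintro _ ⟨f', hf', rfl⟩
  exact hf hf' x

/-- The cpo of Scott-continuous functions, with the pointwise order. -/
def funCpo (X Y : Cpo) : Cpo where
  carrier := {f : X → Y // ScottContinuous f}
  exists_bot := by
    obtain ⟨b, hb⟩ := Y.exists_bot
    exact ⟨⟨fun _ => b, ScottContinuous.const b⟩, fun f x => hb (f.1 x)⟩
  exists_lub D hne hD := by
    obtain ⟨g, hg, _⟩ := exists_pointwise_lub D hne hD
    exact ⟨g, hg⟩

theorem conjugate_cont {X X' Y Y' : Cpo} {p : X' → X} (hp : ScottContinuous p)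
    {e : Y → Y'} (he : ScottContinuous e) :
    ScottContinuous (fun φ : funCpo X Y =>
      (⟨fun x => e (φ.1 (p x)), (hp.comp φ.2).comp he⟩ : funCpo X' Y')) := by
  intro D hne hD φ hφ
  obtain ⟨g, hg, hgx⟩ := exists_pointwise_lub D hne hD
  obtain rfl : g = φ := hg.unique hφ
  have key : ∀ x, IsLUB (e '' ((fun f : funCpo X Y => f.1 (p x)) '' D)) (e (g.1 (p x))) :=
    fun x => he (hne.image _)
      (directedOn_image_of_monotone (fun (f f' : funCpo X Y) hff => (show f.1 ≤ f'.1 from hff) (p x)) hD) (hgx (p x))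
  refine ⟨?_, fun ψ hψ x => (key x).2 ?_⟩
  · rintro _ ⟨f, hf, rfl⟩ x
    exact (key x).1 ⟨_, ⟨f, hf, rfl⟩, rfl⟩
  · rintro _ ⟨_, ⟨f, hf, rfl⟩, rfl⟩
    exact hψ ⟨f, hf, rfl⟩ x

/-- The action of function spaces on embedding-projection pairs. -/
def funEP {X X' Y Y' : Cpo} (f : X ⟶ X') (g : Y ⟶ Y') : funCpo X Y ⟶ funCpo X' Y' where
  emb φ := ⟨fun x => EP.emb g (φ.1 (EP.proj f x)),
    ((EP.proj_cont f).comp φ.2).comp (EP.emb_cont g)⟩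
  proj ψ := ⟨fun x => EP.proj g (ψ.1 (EP.emb f x)),
    ((EP.emb_cont f).comp ψ.2).comp (EP.proj_cont g)⟩
  emb_cont := conjugate_cont (EP.proj_cont f) (EP.emb_cont g)
  proj_cont := conjugate_cont (EP.emb_cont f) (EP.proj_cont g)
  proj_emb φ := Subtype.ext <| funext fun x => by
    simp only [EP.proj_emb]
  emb_proj ψ x := (EP.emb_proj g _).trans (ψ.2.monotone (EP.emb_proj f x))

/-! ## Weak sums -/

theorem isLUB_of_preimage {X S : Type} [PartialOrder X] [PartialOrder S] {i : X → S}
    (hi : ∀ x y, i x ≤ i y ↔ x ≤ y) (hup : ∀ x s, i x ≤ s → ∃ y, i y = s)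
    {D : Set S} (hD : DirectedOn (· ≤ ·) D) {x₀ : X} (hx₀ : i x₀ ∈ D) {a : X}
    (ha : IsLUB (i ⁻¹' D) a) : IsLUB D (i a) := by
  refine ⟨fun y hy => ?_, fun b hb => ?_⟩
  · obtain ⟨z, hz, hyz, hxz⟩ := hD y hy _ hx₀
    obtain ⟨z', rfl⟩ := hup _ _ hxz
    exact hyz.trans ((hi _ _).2 (ha.1 hz))
  · obtain ⟨b', rfl⟩ := hup _ _ (hb hx₀)
    exact (hi _ _).2 (ha.2 fun y hy => (hi _ _).1 (hb hy))

theorem directedOn_preimage {X S : Type} [PartialOrder X] [PartialOrder S] {i : X → S}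
    (hi : ∀ x y, i x ≤ i y ↔ x ≤ y) (hup : ∀ x s, i x ≤ s → ∃ y, i y = s)
    {D : Set S} (hD : DirectedOn (· ≤ ·) D) : DirectedOn (· ≤ ·) (i ⁻¹' D) := by
  intro x hx y hy
  obtain ⟨z, hz, hxz, hyz⟩ := hD _ hx _ hy
  obtain ⟨z', rfl⟩ := hup _ _ hxz
  exact ⟨z', hz, (hi _ _).1 hxz, (hi _ _).1 hyz⟩

/-- The first injection into the disjoint union with a new least element. -/
def sumInl {X Y : Type} (x : X) : WithBot (X ⊕ Y) := ((Sum.inl x : X ⊕ Y) : WithBot (X ⊕ Y))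

/-- The second injection into the disjoint union with a new least element. -/
def sumInr {X Y : Type} (y : Y) : WithBot (X ⊕ Y) := ((Sum.inr y : X ⊕ Y) : WithBot (X ⊕ Y))

theorem sum_cases {X Y : Type} (s : WithBot (X ⊕ Y)) :
    s = ⊥ ∨ (∃ x, s = sumInl x) ∨ ∃ y, s = sumInr y := by
  rcases s with _ | (x | y)
  · exact Or.inl rfl
  · exact Or.inr (Or.inl ⟨x, rfl⟩)
  · exact Or.inr (Or.inr ⟨y, rfl⟩)

section SumOrder

variable {X Y : Type} [PartialOrder X] [PartialOrder Y]

theorem sumInl_le_iff (x y : X) : (sumInl x : WithBot (X ⊕ Y)) ≤ sumInl y ↔ x ≤ y := by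
  simp [sumInl]

theorem sumInr_le_iff (x y : Y) : (sumInr x : WithBot (X ⊕ Y)) ≤ sumInr y ↔ x ≤ y := by
  simp [sumInr]

theorem sumInl_up (x : X) (s : WithBot (X ⊕ Y)) (h : sumInl x ≤ s) : ∃ y, sumInl y = s := by
  rcases sum_cases s with rfl | ⟨y, rfl⟩ | ⟨y, rfl⟩
  · simp [sumInl] at h
  · exact ⟨y, rfl⟩
  · simp [sumInl, sumInr] at h

theorem sumInr_up (x : Y) (s : WithBot (X ⊕ Y)) (h : sumInr x ≤ s) : ∃ y, sumInr y = s := by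
  rcases sum_cases s with rfl | ⟨y, rfl⟩ | ⟨y, rfl⟩
  · simp [sumInr] at h
  · simp [sumInl, sumInr] at h
  · exact ⟨y, rfl⟩

end SumOrder

/-- The weak coproduct of two cpos: their disjoint union, augmented with a new least element. -/
def sumCpo (X Y : Cpo) : Cpo where
  carrier := WithBot (X ⊕ Y)
  exists_bot := ⟨⊥, fun _ => bot_le⟩
  exists_lub D hne hD := by
    by_cases h₁ : ∃ x : X, sumInl x ∈ D
    · obtain ⟨x₀, hx₀⟩ := h₁
      obtain ⟨a, ha⟩ := X.exists_lub _ ⟨x₀, hx₀⟩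
        (directedOn_preimage sumInl_le_iff sumInl_up hD)
      exact ⟨_, isLUB_of_preimage sumInl_le_iff sumInl_up hD hx₀ ha⟩
    by_cases h₂ : ∃ y : Y, sumInr y ∈ D
    · obtain ⟨x₀, hx₀⟩ := h₂
      obtain ⟨a, ha⟩ := Y.exists_lub _ ⟨x₀, hx₀⟩
        (directedOn_preimage sumInr_le_iff sumInr_up hD)
      exact ⟨_, isLUB_of_preimage sumInr_le_iff sumInr_up hD hx₀ ha⟩
    refine ⟨⊥, fun s hs => ?_, fun _ _ => bot_le⟩
    rcases sum_cases s with rfl | ⟨y, rfl⟩ | ⟨y, rfl⟩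
    · exact le_rfl
    · exact (h₁ ⟨y, hs⟩).elim
    · exact (h₂ ⟨y, hs⟩).elim

theorem sumMap_cont {X X' Y Y' : Cpo} {f : X → X'} (hf : ScottContinuous f)
    {g : Y → Y'} (hg : ScottContinuous g) :
    ScottContinuous (WithBot.map (Sum.map f g) : sumCpo X Y → sumCpo X' Y') := by
  have hmono : Monotone (WithBot.map (Sum.map f g) : WithBot (X ⊕ Y) → WithBot (X' ⊕ Y')) :=
    WithBot.monotone_map_iff.2 <| by
      rintro (x | x) (y | y) h
      · simpa using hf.monotone (by simpa using h)
      · simp at h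
      · simp at h
      · simpa using hg.monotone (by simpa using h)
  intro D hne hD a ha
  have hD' := directedOn_image_of_monotone hmono hD
  by_cases h₁ : ∃ x : X, sumInl x ∈ D
  · obtain ⟨x₀, hx₀⟩ := h₁
    have hpd := directedOn_preimage sumInl_le_iff sumInl_up hD
    obtain ⟨a', ha'⟩ := X.exists_lub _ ⟨x₀, hx₀⟩ hpd
    obtain rfl := (isLUB_of_preimage sumInl_le_iff sumInl_up hD hx₀ ha').unique ha
    have hlub := hf ⟨x₀, hx₀⟩ hpd ha'
    refine isLUB_of_preimage (X := X') (i := sumInl) sumInl_le_iff sumInl_up hD'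
      (x₀ := f x₀) ⟨_, hx₀, rfl⟩ ?_
    convert hlub using 1
    ext z
    constructor
    · rintro ⟨s, hs, hsz⟩
      rcases sum_cases s with rfl | ⟨y, rfl⟩ | ⟨y, rfl⟩
      · exact (WithBot.bot_ne_coe hsz).elim
      · exact ⟨y, hs, Sum.inl_injective (WithBot.coe_injective hsz)⟩
      · exact (Sum.inr_ne_inl (WithBot.coe_injective hsz)).elim
    · rintro ⟨y, hy, rfl⟩
      exact ⟨sumInl y, hy, rfl⟩
  by_cases h₂ : ∃ y : Y, sumInr y ∈ D
  · obtain ⟨x₀, hx₀⟩ := h₂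
    have hpd := directedOn_preimage sumInr_le_iff sumInr_up hD
    obtain ⟨a', ha'⟩ := Y.exists_lub _ ⟨x₀, hx₀⟩ hpd
    obtain rfl := (isLUB_of_preimage sumInr_le_iff sumInr_up hD hx₀ ha').unique ha
    have hlub := hg ⟨x₀, hx₀⟩ hpd ha'
    refine isLUB_of_preimage (X := Y') (i := sumInr) sumInr_le_iff sumInr_up hD'
      (x₀ := g x₀) ⟨_, hx₀, rfl⟩ ?_
    convert hlub using 1
    ext z
    constructor
    · rintro ⟨s, hs, hsz⟩
      rcases sum_cases s with rfl | ⟨y, rfl⟩ | ⟨y, rfl⟩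
      · exact (WithBot.bot_ne_coe hsz).elim
      · exact (Sum.inl_ne_inr (WithBot.coe_injective hsz)).elim
      · exact ⟨y, hs, Sum.inr_injective (WithBot.coe_injective hsz)⟩
    · rintro ⟨y, hy, rfl⟩
      exact ⟨sumInr y, hy, rfl⟩
  have hbot : ∀ s ∈ D, s = (⊥ : WithBot (X ⊕ Y)) := fun s hs => by
    rcases sum_cases s with rfl | ⟨y, rfl⟩ | ⟨y, rfl⟩
    · rfl
    · exact (h₁ ⟨y, hs⟩).elim
    · exact (h₂ ⟨y, hs⟩).elim
  obtain ⟨s₀, hs₀⟩ := hne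
  have haD : a ∈ D := by
    have h1 : a ≤ s₀ := ha.2 fun s hs => by rw [hbot s hs, hbot s₀ hs₀]
    have h2 : s₀ ≤ a := ha.1 hs₀
    rwa [le_antisymm h1 h2]
  exact ⟨hmono.mem_upperBounds_image ha.1, fun b hb => hb ⟨a, haD, rfl⟩⟩

/-- The action of weak sums on embedding-projection pairs. -/
def sumEP {X X' Y Y' : Cpo} (f : X ⟶ X') (g : Y ⟶ Y') : sumCpo X Y ⟶ sumCpo X' Y' where
  emb := WithBot.map (Sum.map (EP.emb f) (EP.emb g))
  proj := WithBot.map (Sum.map (EP.proj f) (EP.proj g))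
  emb_cont := sumMap_cont (EP.emb_cont f) (EP.emb_cont g)
  proj_cont := sumMap_cont (EP.proj_cont f) (EP.proj_cont g)
  proj_emb s := by
    rcases sum_cases s with rfl | ⟨y, rfl⟩ | ⟨y, rfl⟩
    · rfl
    · exact congrArg sumInl (EP.proj_emb f y)
    · exact congrArg sumInr (EP.proj_emb g y)
  emb_proj s := by
    rcases sum_cases s with rfl | ⟨y, rfl⟩ | ⟨y, rfl⟩
    · exact le_rfl
    · exact (sumInl_le_iff _ _).2 (EP.emb_proj f y)
    · exact (sumInr_le_iff _ _).2 (EP.emb_proj g y)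

/-! ## Bilimits of countable chains of embedding-projection pairs -/

section Bilimit

/-- The poset underlying the limit of the chain of projections. -/
def LimCarrier (K : ℕ → Cpo) (k : ∀ n, K n ⟶ K (n + 1)) : Type :=
  {x : ∀ n, K n // ∀ n, EP.proj (k n) (x (n + 1)) = x n}

instance (K : ℕ → Cpo) (k : ∀ n, K n ⟶ K (n + 1)) : PartialOrder (LimCarrier K k) :=
  inferInstanceAs (PartialOrder {x : ∀ n, K n // ∀ n, EP.proj (k n) (x (n + 1)) = x n})

theorem exists_lim_lub {K : ℕ → Cpo} {k : ∀ n, K n ⟶ K (n + 1)} (D : Set (LimCarrier K k))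
    (hne : D.Nonempty) (hD : DirectedOn (· ≤ ·) D) :
    ∃ a : LimCarrier K k, IsLUB D a ∧
      ∀ n, IsLUB ((fun x : LimCarrier K k => x.1 n) '' D) (a.1 n) := by
  have hdir : ∀ n, DirectedOn (· ≤ ·) ((fun x : LimCarrier K k => x.1 n) '' D) := fun n =>
    directedOn_image_of_monotone (fun (x y : LimCarrier K k) hxy => (show x.1 ≤ y.1 from hxy) n) hD
  choose a ha using fun n => (K n).exists_lub _ (hne.image _) (hdir n)
  refine ⟨⟨a, fun n => ?_⟩, ⟨fun x hx n => (ha n).1 ⟨x, hx, rfl⟩, fun b hb n => (ha n).2 ?_⟩, ha⟩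
  · have h := EP.proj_cont (k n) (hne.image _) (hdir (n + 1)) (ha (n + 1))
    refine h.unique ?_
    rw [Set.image_image]
    simpa only [fun x : LimCarrier K k => x.2 n] using ha n
  · rintro _ ⟨x, hx, rfl⟩
    exact hb hx n

/-- The bilimit of a chain of embedding-projection pairs: the limit of its projections, with the
pointwise order. -/
def limCpo (K : ℕ → Cpo) (k : ∀ n, K n ⟶ K (n + 1)) : Cpo where
  carrier := LimCarrier K k
  exists_bot := by
    choose b hb using fun n => (K n).exists_bot
    refine ⟨⟨b, fun n => le_antisymm ?_ (hb n _)⟩, fun x n => hb n (x.1 n)⟩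
    calc EP.proj (k n) (b (n + 1))
        ≤ EP.proj (k n) (EP.emb (k n) (b n)) := (EP.proj_cont (k n)).monotone (hb _ _)
      _ = b n := EP.proj_emb _ _
  exists_lub D hne hD := by
    obtain ⟨a, ha, _⟩ := exists_lim_lub D hne hD
    exact ⟨a, ha⟩

/-- The canonical map from the `n`th to the `m`th object of a chain, composed of embeddings
if `n ≤ m` and of projections if `m ≤ n`. -/
def chainHom : (K : ℕ → Cpo) → (k : ∀ n, K n ⟶ K (n + 1)) → (n m : ℕ) → K n → K m
  | _, _, 0, 0 => fun x => x
  | K, k, 0, m + 1 => fun x => EP.emb (k m) (chainHom K k 0 m x)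
  | K, k, n + 1, 0 => fun x => chainHom K k n 0 (EP.proj (k n) x)
  | K, k, n + 1, m + 1 => chainHom (fun i => K (i + 1)) (fun i => k (i + 1)) n m

theorem chainHom_cont : (K : ℕ → Cpo) → (k : ∀ n, K n ⟶ K (n + 1)) → (n m : ℕ) →
    ScottContinuous (chainHom K k n m)
  | _, _, 0, 0 => by
    unfold chainHom
    exact ScottContinuous.id
  | K, k, 0, m + 1 => by
    unfold chainHom
    exact (chainHom_cont K k 0 m).comp (EP.emb_cont (k m))
  | K, k, n + 1, 0 => by
    unfold chainHom
    exact (EP.proj_cont (k n)).comp (chainHom_cont K k n 0)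
  | K, k, n + 1, m + 1 => by
    unfold chainHom
    exact chainHom_cont _ _ n m

theorem chainHom_self : (K : ℕ → Cpo) → (k : ∀ n, K n ⟶ K (n + 1)) → (n : ℕ) → (x : K n) →
    chainHom K k n n x = x
  | _, _, 0, x => by
    unfold chainHom
    rfl
  | K, k, n + 1, x => by
    unfold chainHom
    exact chainHom_self (fun i => K (i + 1)) (fun i => k (i + 1)) n x

theorem chainHom_zero_proj (K : ℕ → Cpo) (k : ∀ n, K n ⟶ K (n + 1)) : (n : ℕ) → (x : K (n + 1)) →
    EP.proj (k 0) (chainHom (fun i => K (i + 1)) (fun i => k (i + 1)) n 0 x) =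
      chainHom K k n 0 (EP.proj (k n) x)
  | 0, x => by
    simp [chainHom]
  | n + 1, x => by
    have := chainHom_zero_proj K k n (EP.proj (k (n + 1)) x)
    simpa [chainHom] using this

theorem chainHom_proj : (K : ℕ → Cpo) → (k : ∀ n, K n ⟶ K (n + 1)) → (n m : ℕ) → (x : K n) →
    EP.proj (k m) (chainHom K k n (m + 1) x) = chainHom K k n m x
  | K, k, 0, m, x => by
    rw [chainHom]
    exact EP.proj_emb _ _
  | K, k, n + 1, 0, x => by
    rw [chainHom, chainHom]
    exact chainHom_zero_proj K k n x
  | K, k, n + 1, m + 1, x => by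
    rw [chainHom, chainHom]
    exact chainHom_proj (fun i => K (i + 1)) (fun i => k (i + 1)) n m x

theorem chainHom_le : (K : ℕ → Cpo) → (k : ∀ n, K n ⟶ K (n + 1)) → (n m : ℕ) →
    (x : ∀ n, K n) → (∀ n, EP.proj (k n) (x (n + 1)) = x n) → chainHom K k n m (x n) ≤ x m
  | K, k, 0, 0, x, _ => by
    rw [chainHom]
  | K, k, 0, m + 1, x, hx => by
    rw [chainHom]
    refine ((EP.emb_cont (k m)).monotone (chainHom_le K k 0 m x hx)).trans ?_
    rw [← hx m]
    exact EP.emb_proj _ _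
  | K, k, n + 1, 0, x, hx => by
    rw [chainHom]
    have h := chainHom_le K k n 0 x hx
    rwa [← hx n] at h
  | K, k, n + 1, m + 1, x, hx => by
    rw [chainHom]
    exact chainHom_le (fun i => K (i + 1)) (fun i => k (i + 1)) n m (fun i => x (i + 1))
      (fun i => hx (i + 1))

variable {K : ℕ → Cpo} {k : ∀ n, K n ⟶ K (n + 1)}

theorem lim_isLUB_apply {D : Set (limCpo K k)} (hne : D.Nonempty) (hD : DirectedOn (· ≤ ·) D)
    {a : limCpo K k} (ha : IsLUB D a) (n : ℕ) :
    IsLUB ((fun x : limCpo K k => x.1 n) '' D) (a.1 n) := by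
  obtain ⟨a', ha', hn⟩ := exists_lim_lub D hne hD
  obtain rfl : a' = a := ha'.unique ha
  exact hn n

theorem lim_cont_of_apply {X : Cpo} {f : X → limCpo K k}
    (hf : ∀ n, ScottContinuous fun x => (f x).1 n) : ScottContinuous f := by
  intro D hne hD a ha
  have key := fun n => hf n hne hD ha
  refine ⟨?_, fun b hb n => (key n).2 ?_⟩
  · rintro _ ⟨x, hx, rfl⟩ n
    exact (key n).1 ⟨x, hx, rfl⟩
  · rintro _ ⟨x, hx, rfl⟩
    exact hb ⟨x, hx, rfl⟩ n

variable (K k)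

/-- The components of the colimiting cocone of a bilimit; the projections are the components of
the limiting cone. -/
def limIn (n : ℕ) : K n ⟶ limCpo K k where
  emb x := ⟨fun m => chainHom K k n m x, fun m => chainHom_proj K k n m x⟩
  proj x := x.1 n
  emb_cont := lim_cont_of_apply fun m => chainHom_cont K k n m
  proj_cont _ hne hD _ ha := lim_isLUB_apply hne hD ha n
  proj_emb x := chainHom_self K k n x
  emb_proj x m := chainHom_le K k n m x.1 x.2

theorem limIn_comp (n : ℕ) : k n ≫ limIn K k (n + 1) = limIn K k n :=
  hom_ext fun x => x.2 n

variable {K k} {C : Cpo} (t : ∀ n, K n ⟶ C)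

theorem cocone_proj (ht : ∀ n, k n ≫ t (n + 1) = t n) (n : ℕ) (y : C) :
    EP.proj (k n) (EP.proj (t (n + 1)) y) = EP.proj (t n) y := by
  rw [← ht n]
  rfl

theorem cocone_emb_mono (ht : ∀ n, k n ≫ t (n + 1) = t n) (x : limCpo K k) :
    Monotone fun n => EP.emb (t n) (x.1 n) :=
  monotone_nat_of_le_succ fun n => by
    rw [← ht n, ← x.2 n]
    exact (EP.emb_cont (t (n + 1))).monotone (EP.emb_proj _ _)

theorem exists_descEmb (ht : ∀ n, k n ≫ t (n + 1) = t n) (x : limCpo K k) :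
    ∃ a, IsLUB (Set.range fun n => EP.emb (t n) (x.1 n)) a :=
  C.exists_lub _ (Set.range_nonempty _)
    (directedOn_range.2 (cocone_emb_mono t ht x).directed_le)

/-- The embedding of the mediating morphism out of a bilimit. -/
noncomputable def descEmb (ht : ∀ n, k n ≫ t (n + 1) = t n) (x : limCpo K k) : C := (exists_descEmb t ht x).choose

theorem descEmb_isLUB (ht : ∀ n, k n ≫ t (n + 1) = t n) (x : limCpo K k) :
    IsLUB (Set.range fun n => EP.emb (t n) (x.1 n)) (descEmb t ht x) :=
  (exists_descEmb t ht x).choose_spec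

theorem cocone_proj_of_le (ht : ∀ n, k n ≫ t (n + 1) = t n) {x : limCpo K k} {n : ℕ}
    {z : C} (hz : EP.proj (t n) z = x.1 n) :
    ∀ m, m ≤ n → EP.proj (t m) z = x.1 m := by
  intro m hm
  induction hm using Nat.decreasingInduction with
  | self => exact hz
  | of_succ j hj ih => rw [← cocone_proj t ht, ih, x.2]

/-- The mediating morphism out of a bilimit, given by its colimit property. -/
noncomputable def limDesc (ht : ∀ n, k n ≫ t (n + 1) = t n) : limCpo K k ⟶ C where
  emb := descEmb t ht
  proj y := ⟨fun n => EP.proj (t n) y, fun n => cocone_proj t ht n y⟩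
  emb_cont := by
    intro D hne hD a ha
    have key : ∀ n, IsLUB (EP.emb (t n) '' ((fun x : limCpo K k => x.1 n) '' D))
        (EP.emb (t n) (a.1 n)) := fun n =>
      EP.emb_cont (t n) (hne.image _)
        (directedOn_image_of_monotone (fun (x y : limCpo K k) hxy => (show x.1 ≤ y.1 from hxy) n) hD)
        (lim_isLUB_apply hne hD ha n)
    refine ⟨?_, fun b hb => (descEmb_isLUB t ht a).2 ?_⟩
    · rintro _ ⟨x, hx, rfl⟩
      refine (descEmb_isLUB t ht x).2 ?_
      rintro _ ⟨n, rfl⟩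
      exact ((key n).1 ⟨_, ⟨x, hx, rfl⟩, rfl⟩).trans ((descEmb_isLUB t ht a).1 ⟨n, rfl⟩)
    · rintro _ ⟨n, rfl⟩
      refine (key n).2 ?_
      rintro _ ⟨_, ⟨x, hx, rfl⟩, rfl⟩
      exact ((descEmb_isLUB t ht x).1 ⟨n, rfl⟩).trans (hb ⟨x, hx, rfl⟩)
  proj_cont := lim_cont_of_apply fun n => EP.proj_cont (t n)
  proj_emb x := by
    refine Subtype.ext (funext fun m => ?_)
    have h := EP.proj_cont (t m) (Set.range_nonempty _)
      (directedOn_range.2 (cocone_emb_mono t ht x).directed_le) (descEmb_isLUB t ht x)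
    refine le_antisymm (h.2 ?_) ?_
    · rintro _ ⟨_, ⟨n, rfl⟩, rfl⟩
      rcases le_total m n with hmn | hnm
      · exact (cocone_proj_of_le t ht (EP.proj_emb (t n) _) m hmn).le
      · refine ((EP.proj_cont (t m)).monotone (cocone_emb_mono t ht x hnm)).trans ?_
        exact (EP.proj_emb (t m) _).le
    · refine le_trans ?_ (h.1 ⟨_, ⟨m, rfl⟩, rfl⟩)
      exact (EP.proj_emb (t m) _).ge
  emb_proj y := (descEmb_isLUB t ht _).2 <| by
    rintro _ ⟨n, rfl⟩
    exact EP.emb_proj (t n) y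

end Bilimit

/-! ## Functors on cpos and embedding-projection pairs -/

/-- Interpretations of `n` type variables. -/
abbrev Env (n : ℕ) : Type 1 := Fin n → Cpo

/-- Extension of an environment by a cpo for the variable `0`. -/
def Env.cons {n : ℕ} (A : Cpo) (X : Env n) : Env (n + 1) := Fin.cons A X

/-- Extension of a morphism of environments. -/
def consMap {n : ℕ} {A B : Cpo} {X Y : Env n} (f : A ⟶ B) (g : X ⟶ Y) :
    Env.cons A X ⟶ Env.cons B Y :=
  fun i => Fin.cases (motive := fun i => Env.cons A X i ⟶ Env.cons B Y i) f g i

theorem consMap_id {n : ℕ} (A : Cpo) (X : Env n) :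
    consMap (𝟙 A) (𝟙 X) = 𝟙 (Env.cons A X) := by
  funext i
  refine Fin.cases ?_ (fun i => ?_) i <;> rfl

theorem consMap_comp {n : ℕ} {A B C : Cpo} {X Y Z : Env n} (f : A ⟶ B) (f' : B ⟶ C)
    (g : X ⟶ Y) (g' : Y ⟶ Z) :
    consMap (f ≫ f') (g ≫ g') = consMap f g ≫ consMap f' g' := by
  funext i
  refine Fin.cases ?_ (fun i => ?_) i <;> rfl

section Functors

variable {n : ℕ}

/-- Products of functors. -/
def prodF (F G : Env n ⥤ Cpo) : Env n ⥤ Cpo where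
  obj X := prodCpo (F.obj X) (G.obj X)
  map f := prodEP (F.map f) (G.map f)
  map_id X := by
    rw [F.map_id, G.map_id]
    exact hom_ext fun _ => rfl
  map_comp f g := by
    rw [F.map_comp, G.map_comp]
    exact hom_ext fun _ => rfl

/-- Function spaces of functors. -/
def funF (F G : Env n ⥤ Cpo) : Env n ⥤ Cpo where
  obj X := funCpo (F.obj X) (G.obj X)
  map f := funEP (F.map f) (G.map f)
  map_id X := by
    rw [F.map_id, G.map_id]
    exact hom_ext fun _ => rfl
  map_comp f g := by
    rw [F.map_comp, G.map_comp]
    exact hom_ext fun _ => rfl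

/-- Weak sums of functors. -/
def sumF (F G : Env n ⥤ Cpo) : Env n ⥤ Cpo where
  obj X := sumCpo (F.obj X) (G.obj X)
  map f := sumEP (F.map f) (G.map f)
  map_id X := by
    rw [F.map_id, G.map_id]
    refine hom_ext fun s => ?_
    rcases sum_cases s with rfl | ⟨y, rfl⟩ | ⟨y, rfl⟩ <;> rfl
  map_comp f g := by
    rw [F.map_comp, G.map_comp]
    refine hom_ext fun s => ?_
    rcases sum_cases s with rfl | ⟨y, rfl⟩ | ⟨y, rfl⟩ <;> rfl

variable (F : Env (n + 1) ⥤ Cpo)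

/-- The objects `1, F(1), F(F(1)), …` of the chain obtained by iterating `F` in its variable `0`
from the initial cpo. -/
noncomputable def chainObj (X : Env n) (m : ℕ) : Cpo :=
  Nat.rec oneCpo (fun _ A => F.obj (Env.cons A X)) m

/-- The connecting morphisms of the chain: the first one is given by initiality, and the
`m + 1`st one is the image under `F` of the `m`th one. -/
noncomputable def chainStep (X : Env n) (m : ℕ) : chainObj F X m ⟶ chainObj F X (m + 1) :=
  Nat.rec (motive := fun m => chainObj F X m ⟶ chainObj F X (m + 1)) (fromOne _)
    (fun _ k => F.map (consMap k (𝟙 X))) m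

/-- The action of a morphism of environments on the chain. -/
noncomputable def chainMap {X Y : Env n} (f : X ⟶ Y) (m : ℕ) : chainObj F X m ⟶ chainObj F Y m :=
  Nat.rec (motive := fun m => chainObj F X m ⟶ chainObj F Y m) (𝟙 oneCpo)
    (fun _ g => F.map (consMap g f)) m

theorem chainMap_step {X Y : Env n} (f : X ⟶ Y) : ∀ m,
    chainStep F X m ≫ chainMap F f (m + 1) = chainMap F f m ≫ chainStep F Y m
  | 0 => fromOne_eq _ _
  | m + 1 =>
    calc F.map (consMap (chainStep F X m) (𝟙 X)) ≫ F.map (consMap (chainMap F f (m + 1)) f)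
        = F.map (consMap (chainStep F X m ≫ chainMap F f (m + 1)) (𝟙 X ≫ f)) := by
          rw [consMap_comp, F.map_comp]
      _ = F.map (consMap (chainMap F f m ≫ chainStep F Y m) (f ≫ 𝟙 Y)) := by
          rw [chainMap_step f m, Category.id_comp, Category.comp_id]
      _ = F.map (consMap (chainMap F f m) f) ≫ F.map (consMap (chainStep F Y m) (𝟙 Y)) := by
          rw [consMap_comp, F.map_comp]

theorem chainMap_id (X : Env n) : ∀ m, chainMap F (𝟙 X) m = 𝟙 _
  | 0 => rfl
  | m + 1 =>
    calc F.map (consMap (chainMap F (𝟙 X) m) (𝟙 X)) = F.map (𝟙 _) := by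
          rw [chainMap_id X m, consMap_id]
      _ = 𝟙 _ := F.map_id _

theorem chainMap_comp {X Y Z : Env n} (f : X ⟶ Y) (g : Y ⟶ Z) : ∀ m,
    chainMap F (f ≫ g) m = chainMap F f m ≫ chainMap F g m
  | 0 => rfl
  | m + 1 =>
    calc F.map (consMap (chainMap F (f ≫ g) m) (f ≫ g))
        = F.map (consMap (chainMap F f m) f) ≫ F.map (consMap (chainMap F g m) g) := by
          rw [chainMap_comp f g m, consMap_comp, F.map_comp]

/-- The bilimit of the chain, as a functor of the environment, for a given natural family of
connecting morphisms. -/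
noncomputable def limF (k : ∀ X m, chainObj F X m ⟶ chainObj F X (m + 1))
    (hk : ∀ {X Y : Env n} (f : X ⟶ Y) (m : ℕ),
      k X m ≫ chainMap F f (m + 1) = chainMap F f m ≫ k Y m) : Env n ⥤ Cpo where
  obj X := limCpo (chainObj F X) (k X)
  map {X Y} f := limDesc (fun m => chainMap F f m ≫ limIn _ (k Y) m) fun m => by
    rw [← Category.assoc, hk, Category.assoc, limIn_comp]
  map_id X := hom_ext fun y => Subtype.ext <| funext fun m => by
    change EP.proj (chainMap F (𝟙 X) m) (y.1 m) = y.1 m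
    rw [chainMap_id]
    rfl
  map_comp f g := hom_ext fun y => Subtype.ext <| funext fun m => by
    change EP.proj (chainMap F (f ≫ g) m) (y.1 m) =
      EP.proj (chainMap F f m) (EP.proj (chainMap F g m) (y.1 m))
    rw [chainMap_comp]
    rfl

theorem limF_congr {k k' : ∀ X m, chainObj F X m ⟶ chainObj F X (m + 1)} (h : k = k')
    (hk : ∀ {X Y : Env n} (f : X ⟶ Y) (m : ℕ),
      k X m ≫ chainMap F f (m + 1) = chainMap F f m ≫ k Y m)
    (hk' : ∀ {X Y : Env n} (f : X ⟶ Y) (m : ℕ),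
      k' X m ≫ chainMap F f (m + 1) = chainMap F f m ≫ k' Y m) :
    limF F k hk = limF F k' hk' := by
  subst h
  rfl

/-- The parametrised solution of the domain equation `A ≅ F(A)`: the bilimit of the chain
obtained by iterating `F` in its variable `0` from the initial cpo. -/
noncomputable def recF : Env n ⥤ Cpo :=
  limF F (chainStep F) (chainMap_step F)

/-- The cocone with vertex `F(Fix F)` over the chain. -/
noncomputable def unfoldCocone (X : Env n) :
    ∀ m, chainObj F X m ⟶ F.obj (Env.cons ((recF F).obj X) X)
  | 0 => fromOne _
  | m + 1 => F.map (consMap (limIn (chainObj F X) (chainStep F X) m) (𝟙 X))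

theorem unfoldCocone_comp (X : Env n) : ∀ m,
    chainStep F X m ≫ unfoldCocone F X (m + 1) = unfoldCocone F X m
  | 0 => fromOne_eq _ _
  | m + 1 =>
    calc F.map (consMap (chainStep F X m) (𝟙 X)) ≫
          F.map (consMap (limIn (chainObj F X) (chainStep F X) (m + 1)) (𝟙 X))
        = F.map (consMap (limIn (chainObj F X) (chainStep F X) m) (𝟙 X)) := by
          rw [← F.map_comp, ← consMap_comp, limIn_comp, Category.comp_id]

/-- The canonical comparison `Fix F ⟶ F(Fix F)` out of the bilimit. -/
noncomputable def unfoldHom (X : Env n) :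
    (recF F).obj X ⟶ F.obj (Env.cons ((recF F).obj X) X) :=
  limDesc (unfoldCocone F X) (unfoldCocone_comp F X)

end Functors

/-! ## Pure types and their interpretation -/

/-- Type expressions with `n` free type variables (as de Bruijn indices);
`recTy` binds the variable `0`. -/
inductive Ty : ℕ → Type
  | unit {n : ℕ} : Ty n
  | prod {n : ℕ} (S T : Ty n) : Ty n
  | arrow {n : ℕ} (S T : Ty n) : Ty n
  | sum {n : ℕ} (S T : Ty n) : Ty n
  | var {n : ℕ} (i : Fin n) : Ty n
  | recTy {n : ℕ} (T : Ty (n + 1)) : Ty n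

/-- Pure types are closed type expressions. -/
abbrev PureTy : Type := Ty 0

namespace Ty

def liftRen {m n : ℕ} (r : Fin m → Fin n) : Fin (m + 1) → Fin (n + 1) :=
  Fin.cases 0 (fun i => (r i).succ)

def rename : {m n : ℕ} → (Fin m → Fin n) → Ty m → Ty n
  | _, _, _, unit => unit
  | _, _, r, prod S T => prod (S.rename r) (T.rename r)
  | _, _, r, arrow S T => arrow (S.rename r) (T.rename r)
  | _, _, r, sum S T => sum (S.rename r) (T.rename r)
  | _, _, r, var i => var (r i)
  | _, _, r, recTy T => recTy (T.rename (liftRen r))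

def liftSubst {m n : ℕ} (s : Fin m → Ty n) : Fin (m + 1) → Ty (n + 1) :=
  Fin.cases (var 0) (fun i => (s i).rename Fin.succ)

/-- Capture-avoiding simultaneous substitution. -/
def subst : {m n : ℕ} → (Fin m → Ty n) → Ty m → Ty n
  | _, _, _, unit => unit
  | _, _, s, prod S T => prod (S.subst s) (T.subst s)
  | _, _, s, arrow S T => arrow (S.subst s) (T.subst s)
  | _, _, s, sum S T => sum (S.subst s) (T.subst s)
  | _, _, s, var i => s i
  | _, _, s, recTy T => recTy (T.subst (liftSubst s))

/-- Substitution of `U` for the variable `0` in `T`. -/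
def inst {n : ℕ} (T : Ty (n + 1)) (U : Ty n) : Ty n :=
  T.subst (Fin.cases U var)

/-- The interpretation of a type expression, as a functor on cpos and embedding-projection
pairs. -/
noncomputable def sem : {n : ℕ} → Ty n → (Env n ⥤ Cpo)
  | _, unit => (Functor.const _).obj twoCpo
  | _, prod S T => prodF S.sem T.sem
  | _, arrow S T => funF S.sem T.sem
  | _, sum S T => sumF S.sem T.sem
  | _, var i => Pi.eval (fun _ => Cpo) i
  | _, recTy T => recF T.sem

end Ty

/-! ### The interpretation of substitution -/

/-- Forgetting the variable `0`. -/
def tailF (n : ℕ) : Env (n + 1) ⥤ Env n := Functor.pi' fun i => Pi.eval (fun _ => Cpo) i.succ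

/-- The action of a functor of environments below the variable `0`. -/
def liftF {m n : ℕ} (H : Env n ⥤ Env m) : Env (n + 1) ⥤ Env (m + 1) where
  obj X := Env.cons (X 0) (H.obj fun i => X i.succ)
  map {X Y} f := consMap (f 0) (H.map (X := fun i => X i.succ) (Y := fun i => Y i.succ)
    fun i => f i.succ)
  map_id X := by
    rw [← consMap_id, ← H.map_id]
    rfl
  map_comp f g := by
    rw [← consMap_comp, ← H.map_comp]
    rfl

theorem chainStep_liftF {m n : ℕ} (H : Env n ⥤ Env m) (F : Env (m + 1) ⥤ Cpo) (X : Env n) :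
    ∀ j, chainStep (liftF H ⋙ F) X j = chainStep F (H.obj X) j
  | 0 => rfl
  | j + 1 => by
    have ih := chainStep_liftF H F X j
    change F.map (consMap (chainStep (liftF H ⋙ F) X j) (H.map (𝟙 X))) =
      F.map (consMap (chainStep F (H.obj X) j) (𝟙 (H.obj X)))
    rw [H.map_id, ih]
    rfl

theorem recF_liftF {m n : ℕ} (H : Env n ⥤ Env m) (F : Env (m + 1) ⥤ Cpo) :
    recF (liftF H ⋙ F) = H ⋙ recF F :=
  limF_congr (liftF H ⋙ F) (funext fun X => funext fun j => chainStep_liftF H F X j)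
    (chainMap_step _) (fun f j => chainMap_step F (H.map f) j)

theorem liftF_pi {m n : ℕ} (G : Fin m → (Env n ⥤ Cpo)) (G' : Fin (m + 1) → (Env (n + 1) ⥤ Cpo))
    (h₀ : G' 0 = Pi.eval (fun _ => Cpo) 0) (hs : ∀ i, G' i.succ = tailF n ⋙ G i) :
    Functor.pi' G' = liftF (Functor.pi' G) := by
  refine Functor.pi_ext _ _ fun i => ?_
  refine Fin.cases ?_ (fun i => ?_) i
  · exact h₀
  · exact hs i

namespace Ty

theorem sem_rename : {m n : ℕ} → (r : Fin m → Fin n) → (T : Ty m) →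
    (T.rename r).sem = Functor.pi' (fun i => Pi.eval (fun _ => Cpo) (r i)) ⋙ T.sem
  | _, _, _, unit => rfl
  | _, _, r, prod S T => by
    rw [rename, sem, sem_rename r S, sem_rename r T]
    rfl
  | _, _, r, arrow S T => by
    rw [rename, sem, sem_rename r S, sem_rename r T]
    rfl
  | _, _, r, sum S T => by
    rw [rename, sem, sem_rename r S, sem_rename r T]
    rfl
  | _, _, _, var _ => rfl
  | _, _, r, recTy T => by
    rw [rename, sem, sem_rename (liftRen r) T,
      liftF_pi (fun i => Pi.eval (fun _ => Cpo) (r i)) _ rfl (fun i => rfl), recF_liftF]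
    rfl

theorem sem_subst : {m n : ℕ} → (s : Fin m → Ty n) → (T : Ty m) →
    (T.subst s).sem = Functor.pi' (fun i => (s i).sem) ⋙ T.sem
  | _, _, _, unit => rfl
  | _, _, s, prod S T => by
    rw [subst, sem, sem_subst s S, sem_subst s T]
    rfl
  | _, _, s, arrow S T => by
    rw [subst, sem, sem_subst s S, sem_subst s T]
    rfl
  | _, _, s, sum S T => by
    rw [subst, sem, sem_subst s S, sem_subst s T]
    rfl
  | _, _, _, var _ => rfl
  | _, _, s, recTy T => by
    rw [subst, sem, sem_subst (liftSubst s) T,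
      liftF_pi (fun i => (s i).sem) _ rfl (fun i => sem_rename Fin.succ (s i)), recF_liftF]
    rfl

theorem sem_inst_obj {n : ℕ} (T : Ty (n + 1)) (U : Ty n) (X : Env n) :
    (T.inst U).sem.obj X = T.sem.obj (Env.cons (U.sem.obj X) X) := by
  rw [inst, sem_subst]
  refine congrArg T.sem.obj (funext fun i => ?_)
  refine Fin.cases ?_ (fun i => ?_) i <;> rfl

/-- The cpo interpreting a pure type. -/
noncomputable def dom (T : PureTy) : Cpo := T.sem.obj Fin.elim0

/-- The unfolding map, from a recursive type to its unfolding: the embedding part of the canonical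
comparison morphism, along the equality of the interpretation of `T[rec T]` with that of `T` at the
interpretation of `rec T`. -/
noncomputable def unfold (T : Ty 1) : dom (recTy T) → dom (T.inst (recTy T)) :=
  EP.emb (unfoldHom T.sem Fin.elim0 ≫ eqToHom (sem_inst_obj T (recTy T) Fin.elim0).symm)

end Ty

/-! ## Formulae -/

/-- Iteration terms; iteration variables are natural numbers. -/
inductive IterTerm : Type
  | var (i : ℕ)
  | zero
  | succ (t : IterTerm)

namespace IterTerm

def freeVars : IterTerm → Set ℕ
  | var i => {i}
  | zero => ∅
  | succ t => t.freeVars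

def eval (r : ℕ → ℕ) : IterTerm → ℕ
  | var i => r i
  | zero => 0
  | succ t => t.eval r + 1

end IterTerm

/-- Fixpoint contexts: the list of the types of the fixpoint variables. -/
abbrev Ctx : Type := List PureTy

/-- `FPVar Γ T` is the type of (de Bruijn) fixpoint variables of type `T` in the context `Γ`. -/
inductive FPVar : Ctx → PureTy → Type
  | here {Γ : Ctx} {T : PureTy} : FPVar (T :: Γ) T
  | there {Γ : Ctx} {S T : PureTy} (x : FPVar Γ T) : FPVar (S :: Γ) T

open Ty in
/-- Raw formulae of type `T` in the fixpoint context `Γ`, regardless of polarities. The binders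
`mu t` and `nu t` (bounded iteration) bind the fixpoint variable `FPVar.here`; the quantifiers
`ex i` and `all i` bind the iteration variable `i`. -/
inductive Form : Ctx → PureTy → Type
  | tt {Γ : Ctx} {T : PureTy} : Form Γ T
  | ff {Γ : Ctx} {T : PureTy} : Form Γ T
  | and {Γ : Ctx} {T : PureTy} (φ ψ : Form Γ T) : Form Γ T
  | or {Γ : Ctx} {T : PureTy} (φ ψ : Form Γ T) : Form Γ T
  | pair {Γ : Ctx} : Form Γ unit
  | fst {Γ : Ctx} {S T : PureTy} (φ : Form Γ S) : Form Γ (prod S T)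
  | snd {Γ : Ctx} {S T : PureTy} (φ : Form Γ T) : Form Γ (prod S T)
  | inl {Γ : Ctx} {S T : PureTy} (φ : Form Γ S) : Form Γ (sum S T)
  | inr {Γ : Ctx} {S T : PureTy} (φ : Form Γ T) : Form Γ (sum S T)
  | fold {Γ : Ctx} {T : Ty 1} (φ : Form Γ (T.inst (recTy T))) : Form Γ (recTy T)
  | fpvar {Γ : Ctx} {T : PureTy} (x : FPVar Γ T) : Form Γ T
  | mu {Γ : Ctx} {T : PureTy} (t : IterTerm) (φ : Form (T :: Γ) T) : Form Γ T
  | nu {Γ : Ctx} {T : PureTy} (t : IterTerm) (φ : Form (T :: Γ) T) : Form Γ T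
  | ex {Γ : Ctx} {T : PureTy} (i : ℕ) (φ : Form Γ T) : Form Γ T
  | all {Γ : Ctx} {T : PureTy} (i : ℕ) (φ : Form Γ T) : Form Γ T
  | realto {Γ : Ctx} {S T : PureTy} (ψ : Form [] S) (φ : Form [] T) : Form Γ (arrow S T)

/-- The free iteration variables of a formula. -/
def Form.freeVars : {Γ : Ctx} → {T : PureTy} → Form Γ T → Set ℕ
  | _, _, .tt => ∅
  | _, _, .ff => ∅
  | _, _, .and φ ψ => φ.freeVars ∪ ψ.freeVars
  | _, _, .or φ ψ => φ.freeVars ∪ ψ.freeVars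
  | _, _, .pair => ∅
  | _, _, .fst φ => φ.freeVars
  | _, _, .snd φ => φ.freeVars
  | _, _, .inl φ => φ.freeVars
  | _, _, .inr φ => φ.freeVars
  | _, _, .fold φ => φ.freeVars
  | _, _, .fpvar _ => ∅
  | _, _, .mu t φ => t.freeVars ∪ φ.freeVars
  | _, _, .nu t φ => t.freeVars ∪ φ.freeVars
  | _, _, .ex i φ => φ.freeVars \ {i}
  | _, _, .all i φ => φ.freeVars \ {i}
  | _, _, .realto ψ φ => ψ.freeVars ∪ φ.freeVars

mutual

/-- `PosIn i φ`: the iteration variable `i` occurs positively in `φ`. -/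
inductive PosIn : ℕ → {Γ : Ctx} → {T : PureTy} → Form Γ T → Prop
  | notFree {i : ℕ} {Γ : Ctx} {T : PureTy} {φ : Form Γ T} : i ∉ φ.freeVars → PosIn i φ
  | and {i : ℕ} {Γ : Ctx} {T : PureTy} {φ ψ : Form Γ T} :
      PosIn i φ → PosIn i ψ → PosIn i (Form.and φ ψ)
  | or {i : ℕ} {Γ : Ctx} {T : PureTy} {φ ψ : Form Γ T} :
      PosIn i φ → PosIn i ψ → PosIn i (Form.or φ ψ)
  | fst {i : ℕ} {Γ : Ctx} {S T : PureTy} {φ : Form Γ S} :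
      PosIn i φ → PosIn i (Form.fst (T := T) φ)
  | snd {i : ℕ} {Γ : Ctx} {S T : PureTy} {φ : Form Γ T} :
      PosIn i φ → PosIn i (Form.snd (S := S) φ)
  | inl {i : ℕ} {Γ : Ctx} {S T : PureTy} {φ : Form Γ S} :
      PosIn i φ → PosIn i (Form.inl (T := T) φ)
  | inr {i : ℕ} {Γ : Ctx} {S T : PureTy} {φ : Form Γ T} :
      PosIn i φ → PosIn i (Form.inr (S := S) φ)
  | fold {i : ℕ} {Γ : Ctx} {T : Ty 1} {φ : Form Γ (T.inst (Ty.recTy T))} :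
      PosIn i φ → PosIn i (Form.fold φ)
  | realto {i : ℕ} {Γ : Ctx} {S T : PureTy} {ψ : Form [] S} {φ : Form [] T} :
      NegIn i ψ → PosIn i φ → PosIn i (Form.realto (Γ := Γ) ψ φ)
  | ex {i j : ℕ} {Γ : Ctx} {T : PureTy} {φ : Form Γ T} : PosIn i φ → PosIn i (Form.ex j φ)
  | mu {i : ℕ} {Γ : Ctx} {T : PureTy} {t : IterTerm} {φ : Form (T :: Γ) T} :
      PosIn i φ → PosIn i (Form.mu t φ)
  | nu {i : ℕ} {Γ : Ctx} {T : PureTy} {t : IterTerm} {φ : Form (T :: Γ) T} :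
      PosIn i φ → i ∉ t.freeVars → PosIn i (Form.nu t φ)

/-- `NegIn i φ`: the iteration variable `i` occurs negatively in `φ`. -/
inductive NegIn : ℕ → {Γ : Ctx} → {T : PureTy} → Form Γ T → Prop
  | notFree {i : ℕ} {Γ : Ctx} {T : PureTy} {φ : Form Γ T} : i ∉ φ.freeVars → NegIn i φ
  | and {i : ℕ} {Γ : Ctx} {T : PureTy} {φ ψ : Form Γ T} :
      NegIn i φ → NegIn i ψ → NegIn i (Form.and φ ψ)
  | or {i : ℕ} {Γ : Ctx} {T : PureTy} {φ ψ : Form Γ T} :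
      NegIn i φ → NegIn i ψ → NegIn i (Form.or φ ψ)
  | fst {i : ℕ} {Γ : Ctx} {S T : PureTy} {φ : Form Γ S} :
      NegIn i φ → NegIn i (Form.fst (T := T) φ)
  | snd {i : ℕ} {Γ : Ctx} {S T : PureTy} {φ : Form Γ T} :
      NegIn i φ → NegIn i (Form.snd (S := S) φ)
  | inl {i : ℕ} {Γ : Ctx} {S T : PureTy} {φ : Form Γ S} :
      NegIn i φ → NegIn i (Form.inl (T := T) φ)
  | inr {i : ℕ} {Γ : Ctx} {S T : PureTy} {φ : Form Γ T} :
      NegIn i φ → NegIn i (Form.inr (S := S) φ)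
  | fold {i : ℕ} {Γ : Ctx} {T : Ty 1} {φ : Form Γ (T.inst (Ty.recTy T))} :
      NegIn i φ → NegIn i (Form.fold φ)
  | realto {i : ℕ} {Γ : Ctx} {S T : PureTy} {ψ : Form [] S} {φ : Form [] T} :
      PosIn i ψ → NegIn i φ → NegIn i (Form.realto (Γ := Γ) ψ φ)
  | all {i j : ℕ} {Γ : Ctx} {T : PureTy} {φ : Form Γ T} : NegIn i φ → NegIn i (Form.all j φ)
  | nu {i : ℕ} {Γ : Ctx} {T : PureTy} {t : IterTerm} {φ : Form (T :: Γ) T} :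
      NegIn i φ → NegIn i (Form.nu t φ)
  | mu {i : ℕ} {Γ : Ctx} {T : PureTy} {t : IterTerm} {φ : Form (T :: Γ) T} :
      NegIn i φ → i ∉ t.freeVars → NegIn i (Form.mu t φ)

end

/-- The polarities `±`, `+` and `-`. -/
inductive Sign : Type
  | neutral
  | pos
  | neg

def Sign.opp : Sign → Sign
  | neutral => neutral
  | pos => neg
  | neg => pos

/-- `Lang s φ`: the formula `φ`, of type `T` in the fixpoint context `Γ`, has polarity `s`. -/
inductive Lang : Sign → {Γ : Ctx} → {T : PureTy} → Form Γ T → Prop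
  | tt {s : Sign} {Γ : Ctx} {T : PureTy} : Lang s (Form.tt : Form Γ T)
  | ff {s : Sign} {Γ : Ctx} {T : PureTy} : Lang s (Form.ff : Form Γ T)
  | and {s : Sign} {Γ : Ctx} {T : PureTy} {φ ψ : Form Γ T} :
      Lang s φ → Lang s ψ → Lang s (Form.and φ ψ)
  | or {s : Sign} {Γ : Ctx} {T : PureTy} {φ ψ : Form Γ T} :
      Lang s φ → Lang s ψ → Lang s (Form.or φ ψ)
  | pair {s : Sign} {Γ : Ctx} : Lang s (Form.pair : Form Γ Ty.unit)
  | fst {s : Sign} {Γ : Ctx} {S T : PureTy} {φ : Form Γ S} :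
      Lang s φ → Lang s (Form.fst (T := T) φ)
  | snd {s : Sign} {Γ : Ctx} {S T : PureTy} {φ : Form Γ T} :
      Lang s φ → Lang s (Form.snd (S := S) φ)
  | inl {s : Sign} {Γ : Ctx} {S T : PureTy} {φ : Form Γ S} :
      Lang s φ → Lang s (Form.inl (T := T) φ)
  | inr {s : Sign} {Γ : Ctx} {S T : PureTy} {φ : Form Γ T} :
      Lang s φ → Lang s (Form.inr (S := S) φ)
  | fold {s : Sign} {Γ : Ctx} {T : Ty 1} {φ : Form Γ (T.inst (Ty.recTy T))} :
      Lang s φ → Lang s (Form.fold φ)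
  | fpvar {s : Sign} {Γ : Ctx} {T : PureTy} (x : FPVar Γ T) : Lang s (Form.fpvar x)
  | mu {s : Sign} {Γ : Ctx} {T : PureTy} {t : IterTerm} {φ : Form (T :: Γ) T} :
      Lang s φ → Lang s (Form.mu t φ)
  | nu {s : Sign} {Γ : Ctx} {T : PureTy} {t : IterTerm} {φ : Form (T :: Γ) T} :
      Lang s φ → Lang s (Form.nu t φ)
  | ex {i : ℕ} {Γ : Ctx} {T : PureTy} {φ : Form Γ T} :
      Lang Sign.pos φ → PosIn i φ → Lang Sign.pos (Form.ex i φ)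
  | all {i : ℕ} {Γ : Ctx} {T : PureTy} {φ : Form Γ T} :
      Lang Sign.neg φ → NegIn i φ → Lang Sign.neg (Form.all i φ)
  | realto {s : Sign} {Γ : Ctx} {S T : PureTy} {ψ : Form [] S} {φ : Form [] T} :
      Lang s.opp ψ → Lang s φ → Lang s (Form.realto (Γ := Γ) ψ φ)

/-! ## Semantics of formulae -/

/-- Valuations of the fixpoint variables of a context. -/
def FPVal (Γ : Ctx) : Type := ∀ T : PureTy, FPVar Γ T → Set T.dom

/-- The valuation of the empty fixpoint context. -/
def FPVal.nil : FPVal [] := fun _ x => nomatch x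

/-- Extension of a valuation by a value for the variable `FPVar.here`. -/
def FPVal.cons {Γ : Ctx} {S : PureTy} (P : Set S.dom) (v : FPVal Γ) : FPVal (S :: Γ)
  | _, .here => P
  | _, .there x => v _ x

/-- The interpretation of a formula under a valuation `v` of its fixpoint variables and a valuation
`r` of the iteration variables. The formulae `mu t φ` and `nu t φ` denote the `t`-fold iteration of
`φ` as a function of its fixpoint variable, from falsity and from truth respectively. -/
noncomputable def Form.sem : {Γ : Ctx} → {T : PureTy} → Form Γ T → FPVal Γ → (ℕ → ℕ) → Set T.dom
  | _, _, .tt, _, _ => Set.univ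
  | _, _, .ff, _, _ => ∅
  | _, _, .and φ ψ, v, r => φ.sem v r ∩ ψ.sem v r
  | _, _, .or φ ψ, v, r => φ.sem v r ∪ ψ.sem v r
  | _, _, .pair, _, _ => ({(⊤ : Prop)} : Set Prop)
  | _, _, .fst (S := S) (T := T) φ, v, r => {p : S.dom × T.dom | p.1 ∈ φ.sem v r}
  | _, _, .snd (S := S) (T := T) φ, v, r => {p : S.dom × T.dom | p.2 ∈ φ.sem v r}
  | _, _, .inl (S := S) (T := T) φ, v, r =>
      (sumInl '' φ.sem v r : Set (WithBot (S.dom ⊕ T.dom)))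
  | _, _, .inr (S := S) (T := T) φ, v, r =>
      (sumInr '' φ.sem v r : Set (WithBot (S.dom ⊕ T.dom)))
  | _, _, .fold φ, v, r => {x | Ty.unfold _ x ∈ φ.sem v r}
  | _, _, .fpvar x, v, _ => v _ x
  | _, _, .mu t φ, v, r => (fun P => φ.sem (FPVal.cons P v) r)^[t.eval r] ∅
  | _, _, .nu t φ, v, r => (fun P => φ.sem (FPVal.cons P v) r)^[t.eval r] Set.univ
  | _, _, .ex i φ, v, r => ⋃ n : ℕ, φ.sem v (Function.update r i n)
  | _, _, .all i φ, v, r => ⋂ n : ℕ, φ.sem v (Function.update r i n)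
  | _, _, .realto (S := S) (T := T) ψ φ, _, r =>
      {f : {f : S.dom → T.dom // ScottContinuous f} |
        ∀ x ∈ ψ.sem FPVal.nil r, f.1 x ∈ φ.sem FPVal.nil r}

end PolarLogic

namespace PolarLogic

/-! ## Closure properties of Scott domains -/

section ScottDomain

-- Scott domains are stable under every type constructor. For function spaces the compact elements
-- come from step functions, and bounded joins are pointwise. For bilimits, embeddings are left
-- adjoint to Scott-continuous projections, so they carry compact elements of the stages into the
-- bilimit. Induction on type expressions, with an environment of Scott domains, gives the first
-- claim.
--
-- Formulae are treated by one induction for both polarities, since implication exchanges them.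
-- Positive formulae denote Scott-open sets. Compact saturated sets are an inconvenient invariant
-- for negative formulae, because compactness does not obviously pass to intersections or to inverse
-- images along projections. It is replaced by being an upper set closed in the Lawson topology, for
-- which both are immediate. On a Scott domain the Lawson topology is compact
-- (`IsScottDomain.isCompact_lawson`) and finer than the Scott topology
-- (`IsScottDomain.lawson_le_scott`), so such sets are Scott-compact and saturated.
--
-- Inverse images of Lawson-closed sets are controlled by left adjoints: if `e ≤ f x` is equivalent
-- to `d ≤ x` with `d` compact, then `f` is Lawson-continuous. For `unfold` this needs an
-- isomorphism and not just an embedding, whence the section on local continuity: the functors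
-- interpreting types preserve exhausting cocones (`Ty.locallyContinuous_sem`).
--
-- Implication carries the interplay of the polarities. Mapping a compact set into an open set is an
-- open condition by a directed-cover argument (`scottOpen_arrow`). Mapping an open set into a
-- Lawson-closed upper set need only be tested at the compact elements of the open set, hence is an
-- intersection of closed conditions (`lawsonClosedUpper_arrow`). Bounded fixpoints are finite
-- iterations starting from the empty or the full set. Neutral formulae have both polarities.

theorem isCompactElement_of_forall_le {X : Cpo} {b : X} (hb : ∀ x, b ≤ x) : IsCompactElement b :=
  fun _ _ ⟨x, hx⟩ _ _ _ => ⟨x, hx, hb x⟩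

theorem isCompactElement_lub_pair {X : Cpo} {d e z : X} (hd : IsCompactElement d)
    (he : IsCompactElement e) (hz : IsLUB {d, e} z) : IsCompactElement z := by
  intro D a hne hD ha hza
  obtain ⟨x, hx, hdx⟩ := hd D a hne hD ha ((hz.1 (by simp)).trans hza)
  obtain ⟨y, hy, hey⟩ := he D a hne hD ha ((hz.1 (by simp)).trans hza)
  obtain ⟨w, hw, hxw, hyw⟩ := hD x hx y hy
  refine ⟨w, hw, hz.2 ?_⟩
  rintro _ (rfl | rfl)
  exacts [hdx.trans hxw, hey.trans hyw]

/-- A bounded-complete cpo is a Scott domain as soon as its order is determined by its compact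
elements. -/
theorem IsScottDomain.of_le {X : Cpo}
    (h : ∀ x b : X, (∀ d, IsCompactElement d → d ≤ x → d ≤ b) → x ≤ b)
    (hbc : ∀ x y b : X, x ≤ b → y ≤ b → ∃ z, IsLUB {x, y} z) : IsScottDomain X where
  approx_nonempty x := by
    obtain ⟨b, hb⟩ := X.exists_bot
    exact ⟨b, isCompactElement_of_forall_le hb, hb x⟩
  approx_directed := by
    rintro x d ⟨hd, hdx⟩ e ⟨he, hex⟩
    -- The point `x` itself bounds `d` and `e`, so bounded completeness alone yields directedness.
    obtain ⟨z, hz⟩ := hbc d e x hdx hex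
    refine ⟨z, ⟨isCompactElement_lub_pair hd he hz, hz.2 ?_⟩, hz.1 (by simp), hz.1 (by simp)⟩
    rintro _ (rfl | rfl)
    exacts [hdx, hex]
  approx_isLUB x := ⟨fun d hd => hd.2, fun b hb => h x b fun d hd hdx => hb ⟨hd, hdx⟩⟩
  bounded_complete := by
    rintro x y ⟨b, hb⟩
    exact hbc x y b (hb (by simp)) (hb (by simp))

theorem IsScottDomain.le_of_forall {X : Cpo} (hX : IsScottDomain X) {x b : X}
    (h : ∀ d, IsCompactElement d → d ≤ x → d ≤ b) : x ≤ b :=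
  (hX.approx_isLUB x).2 fun d hd => h d hd.1 hd.2

theorem IsScottDomain.exists_lub_of_le {X : Cpo} (hX : IsScottDomain X) {x y b : X}
    (hx : x ≤ b) (hy : y ≤ b) : ∃ z, IsLUB {x, y} z :=
  hX.bounded_complete x y ⟨b, by rintro _ (rfl | rfl) <;> assumption⟩

theorem isLUB_pair_iff {α : Type} [PartialOrder α] {x y z : α} :
    IsLUB {x, y} z ↔ x ≤ z ∧ y ≤ z ∧ ∀ b, x ≤ b → y ≤ b → z ≤ b := by
  constructor
  · intro h
    refine ⟨h.1 (by simp), h.1 (by simp), fun b hx hy => h.2 ?_⟩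
    rintro _ (rfl | rfl) <;> assumption
  · rintro ⟨hx, hy, h⟩
    refine ⟨?_, fun b hb => h b (hb (by simp)) (hb (by simp))⟩
    rintro _ (rfl | rfl) <;> assumption

-- The one-point and two-point cpos

theorem isScottDomain_oneCpo : IsScottDomain oneCpo :=
  IsScottDomain.of_le (fun _ _ _ => le_rfl) fun x _ _ _ _ =>
    ⟨x, isLUB_pair_iff.2 ⟨le_rfl, le_rfl, fun _ _ _ => le_rfl⟩⟩

theorem isCompactElement_true : IsCompactElement (α := twoCpo) (True : Prop) := by
  intro D a hne hD ha h
  by_contra hcon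
  push Not at hcon
  -- If no member of `D` holds, then `False` already bounds `D`, and the supremum cannot be above
  -- `True`.
  have hub : (False : Prop) ∈ upperBounds D := fun p hp hp' => hcon p hp fun _ => hp'
  exact ha.2 hub (h trivial)

theorem isScottDomain_twoCpo : IsScottDomain twoCpo := by
  refine IsScottDomain.of_le (fun x b h => ?_) fun x y _ _ _ => ⟨(x ∨ y : Prop), ?_⟩
  · intro hx
    exact h (True : Prop) isCompactElement_true (fun _ => hx) trivial
  · exact isLUB_pair_iff.2 ⟨Or.inl, Or.inr, fun _ h h' => Or.rec h h'⟩

/-! ### Products -/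

theorem isCompactElement_pair {X Y : Cpo} {d : X} {e : Y} (hd : IsCompactElement d)
    (he : IsCompactElement e) : IsCompactElement (α := prodCpo X Y) (d, e) := by
  intro D a hne hD ha h
  have hab := isLUB_prod.1 ha
  obtain ⟨_, ⟨p, hp, rfl⟩, hdp⟩ := hd _ _ (hne.image _)
    (directedOn_image_of_monotone monotone_fst hD) hab.1 h.1
  obtain ⟨_, ⟨q, hq, rfl⟩, heq⟩ := he _ _ (hne.image _)
    (directedOn_image_of_monotone monotone_snd hD) hab.2 h.2
  obtain ⟨w, hw, hpw, hqw⟩ := hD p hp q hq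
  exact ⟨w, hw, hdp.trans hpw.1, heq.trans hqw.2⟩

theorem IsScottDomain.prod {X Y : Cpo} (hX : IsScottDomain X) (hY : IsScottDomain Y) :
    IsScottDomain (prodCpo X Y) := by
  refine IsScottDomain.of_le (fun x b h => ?_) ?_
  · obtain ⟨b₁, hb₁⟩ := X.exists_bot
    obtain ⟨b₂, hb₂⟩ := Y.exists_bot
    refine ⟨hX.le_of_forall fun d hd hdx => ?_, hY.le_of_forall fun d hd hdx => ?_⟩
    · exact (h (d, b₂) (isCompactElement_pair hd (isCompactElement_of_forall_le hb₂))
        ⟨hdx, hb₂ _⟩).1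
    · exact (h (b₁, d) (isCompactElement_pair (isCompactElement_of_forall_le hb₁) hd)
        ⟨hb₁ _, hdx⟩).2
  · rintro x y b hx hy
    obtain ⟨z₁, h₁⟩ := hX.exists_lub_of_le hx.1 hy.1
    obtain ⟨z₂, h₂⟩ := hY.exists_lub_of_le hx.2 hy.2
    rw [isLUB_pair_iff] at h₁ h₂
    exact ⟨(z₁, z₂), isLUB_pair_iff.2 ⟨⟨h₁.1, h₂.1⟩, ⟨h₁.2.1, h₂.2.1⟩, fun c hc hc' =>
      ⟨h₁.2.2 _ hc.1 hc'.1, h₂.2.2 _ hc.2 hc'.2⟩⟩⟩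

/-! ### Weak sums -/

/-- Both injections into a weak sum are order embeddings whose range is an upper set. Arguments
about them are carried out once, for any such `i`. -/
theorem isLUB_pair_of_up {X S : Cpo} {i : X → S} (hi : ∀ x y, i x ≤ i y ↔ x ≤ y)
    (hup : ∀ x s, i x ≤ s → ∃ y, i y = s) {x y z : X} (h : IsLUB {x, y} z) : IsLUB {i x, i y} (i z) := by
  rw [isLUB_pair_iff] at h ⊢
  refine ⟨(hi _ _).2 h.1, (hi _ _).2 h.2.1, fun b hx hy => ?_⟩
  obtain ⟨b, rfl⟩ := hup _ _ hx
  exact (hi _ _).2 (h.2.2 b ((hi _ _).1 hx) ((hi _ _).1 hy))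

/-- A directed set whose supremum lies above `i d` must meet the range of `i`: otherwise the outside
point `c` would bound it, forcing `c` into the range. From then on suprema can be computed in `X`.
-/
theorem isCompactElement_of_up {X S : Cpo} {i : X → S} (hi : ∀ x y, i x ≤ i y ↔ x ≤ y)
    (hup : ∀ x s, i x ≤ s → ∃ y, i y = s) {c : S} (hc : ∀ x, i x ≠ c)
    (hci : ∀ x s, s ≤ i x → s = c ∨ ∃ y, i y = s) {d : X} (hd : IsCompactElement d) :
    IsCompactElement (i d) := by
  intro D a hne hD ha hda
  have hex : ∃ x, i x ∈ D := by
    by_contra hcon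
    push Not at hcon
    obtain ⟨y, rfl⟩ := hup _ _ hda
    have hub : c ∈ upperBounds D := fun s hs => by
      rcases hci y s (ha.1 hs) with h | ⟨x, rfl⟩
      · exact h.le
      · exact (hcon x hs).elim
    obtain ⟨z, hz⟩ := hup _ _ (ha.2 hub)
    exact hc z hz
  obtain ⟨x₀, hx₀⟩ := hex
  have hD' := directedOn_preimage hi hup hD
  obtain ⟨c, hc⟩ := X.exists_lub (i ⁻¹' D) ⟨x₀, hx₀⟩ hD'
  obtain rfl := (isLUB_of_preimage hi hup hD hx₀ hc).unique ha
  obtain ⟨x, hx, hdx⟩ := hd _ _ ⟨x₀, hx₀⟩ hD' hc ((hi _ _).1 hda)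
  exact ⟨i x, hx, (hi _ _).2 hdx⟩

theorem le_of_up {X S : Cpo} {i : X → S} (hi : ∀ x y, i x ≤ i y ↔ x ≤ y)
    (hup : ∀ x s, i x ≤ s → ∃ y, i y = s) (hcpt : ∀ d, IsCompactElement d → IsCompactElement (i d))
    (hX : IsScottDomain X) {x : X} {b : S}
    (h : ∀ d, IsCompactElement d → d ≤ i x → d ≤ b) : i x ≤ b := by
  obtain ⟨b₀, hb₀⟩ := X.exists_bot
  -- Testing on the image of the least element puts `b` in the range of `i`.
  obtain ⟨b, rfl⟩ := hup _ _ (h (i b₀) (hcpt _ (isCompactElement_of_forall_le hb₀))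
    ((hi _ _).2 (hb₀ _)))
  exact (hi _ _).2 (hX.le_of_forall fun d hd hdx => (hi _ _).1
    (h _ (hcpt d hd) ((hi _ _).2 hdx)))

theorem isCompactElement_sumInl {X Y : Cpo} {d : X} (hd : IsCompactElement d) :
    IsCompactElement (α := sumCpo X Y) (sumInl d) := by
  refine isCompactElement_of_up (S := sumCpo X Y) (i := sumInl) (c := (⊥ : WithBot (X ⊕ Y)))
    sumInl_le_iff sumInl_up
    (fun x => WithBot.coe_ne_bot) (fun x s hs => ?_) hd
  rcases sum_cases s with rfl | ⟨y, rfl⟩ | ⟨y, rfl⟩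
  · exact Or.inl rfl
  · exact Or.inr ⟨_, rfl⟩
  · obtain ⟨z, hz⟩ := sumInr_up _ _ hs
    exact (Sum.inr_ne_inl (WithBot.coe_injective hz)).elim

theorem isCompactElement_sumInr {X Y : Cpo} {d : Y} (hd : IsCompactElement d) :
    IsCompactElement (α := sumCpo X Y) (sumInr d) := by
  refine isCompactElement_of_up (S := sumCpo X Y) (i := sumInr) (c := (⊥ : WithBot (X ⊕ Y)))
    sumInr_le_iff sumInr_up
    (fun x => WithBot.coe_ne_bot) (fun x s hs => ?_) hd
  rcases sum_cases s with rfl | ⟨y, rfl⟩ | ⟨y, rfl⟩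
  · exact Or.inl rfl
  · obtain ⟨z, hz⟩ := sumInl_up _ _ hs
    exact (Sum.inl_ne_inr (WithBot.coe_injective hz)).elim
  · exact Or.inr ⟨_, rfl⟩

theorem isLUB_pair_of_le {α : Type} [PartialOrder α] {x y : α} (h : x ≤ y) :
    IsLUB {x, y} y := isLUB_pair_iff.2 ⟨h, le_rfl, fun _ _ h' => h'⟩

theorem IsScottDomain.sum {X Y : Cpo} (hX : IsScottDomain X) (hY : IsScottDomain Y) :
    IsScottDomain (sumCpo X Y) := by
  refine IsScottDomain.of_le (fun (x b : WithBot (X ⊕ Y)) h => ?_) ?_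
  · rcases sum_cases x with rfl | ⟨x, rfl⟩ | ⟨x, rfl⟩
    · exact (bot_le : (⊥ : WithBot (X ⊕ Y)) ≤ b)
    · exact le_of_up (S := sumCpo X Y) (i := sumInl) sumInl_le_iff sumInl_up
        (fun _ => isCompactElement_sumInl) hX h
    · exact le_of_up (S := sumCpo X Y) (i := sumInr) sumInr_le_iff sumInr_up
        (fun _ => isCompactElement_sumInr) hY h
  · intro (x : WithBot (X ⊕ Y)) (y : WithBot (X ⊕ Y)) b hx hy
    have hbot : ∀ s : sumCpo X Y, (⊥ : WithBot (X ⊕ Y)) ≤ s :=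
      fun s => (bot_le : (⊥ : WithBot (X ⊕ Y)) ≤ s)
    rcases sum_cases x with rfl | ⟨x, rfl⟩ | ⟨x, rfl⟩
    · exact ⟨y, isLUB_pair_of_le (hbot y)⟩
    · rcases sum_cases y with rfl | ⟨y, rfl⟩ | ⟨y, rfl⟩
      · exact ⟨_, Set.pair_comm _ _ ▸ isLUB_pair_of_le (hbot (sumInl x))⟩
      · obtain ⟨b, rfl⟩ := sumInl_up _ _ hx
        obtain ⟨z, hz⟩ := hX.exists_lub_of_le ((sumInl_le_iff _ _).1 hx) ((sumInl_le_iff _ _).1 hy)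
        exact ⟨_, isLUB_pair_of_up (S := sumCpo X Y) sumInl_le_iff sumInl_up hz⟩
      -- Elements of different summands have no common upper bound.
      · obtain ⟨b, rfl⟩ := sumInl_up _ _ hx
        obtain ⟨z, hz⟩ := sumInr_up _ _ hy
        exact (Sum.inr_ne_inl (WithBot.coe_injective hz)).elim
    · rcases sum_cases y with rfl | ⟨y, rfl⟩ | ⟨y, rfl⟩
      · exact ⟨_, Set.pair_comm _ _ ▸ isLUB_pair_of_le (hbot (sumInr x))⟩
      · obtain ⟨b, rfl⟩ := sumInl_up _ _ hy
        obtain ⟨z, hz⟩ := sumInr_up _ _ hx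
        exact (Sum.inr_ne_inl (WithBot.coe_injective hz)).elim
      · obtain ⟨b, rfl⟩ := sumInr_up _ _ hx
        obtain ⟨z, hz⟩ := hY.exists_lub_of_le ((sumInr_le_iff _ _).1 hx) ((sumInr_le_iff _ _).1 hy)
        exact ⟨_, isLUB_pair_of_up (S := sumCpo X Y) sumInr_le_iff sumInr_up hz⟩

/-! ### Function spaces -/

theorem fun_isLUB_apply {X Y : Cpo} {D : Set (funCpo X Y)} (hne : D.Nonempty)
    (hD : DirectedOn (· ≤ ·) D) {f : funCpo X Y} (hf : IsLUB D f) (x : X) :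
    IsLUB ((fun g : funCpo X Y => g.1 x) '' D) (f.1 x) := by
  obtain ⟨g, hg, hgx⟩ := exists_pointwise_lub D hne hD
  obtain rfl : g = f := hg.unique hf
  exact hgx x

open Classical in
/-- The step function with value `e` above `d` and value `⊥` elsewhere. -/
noncomputable def stepFun {X Y : Cpo} {d : X} (hd : IsCompactElement d) (e : Y) : funCpo X Y :=
  ⟨fun x => if d ≤ x then e else Y.exists_bot.choose, by
    have hbot := Y.exists_bot.choose_spec
    intro D hne hD a ha
    constructor
    · rintro _ ⟨x, hx, rfl⟩
      dsimp only
      split_ifs with h₁ h₂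
      · exact le_rfl
      · exact (h₂ (h₁.trans (ha.1 hx))).elim
      · exact hbot _
      · exact le_rfl
    · intro b hb
      dsimp only
      split_ifs with h
      -- Compactness of `d` is exactly what keeps the jump at `d` continuous.
      · obtain ⟨x, hx, hdx⟩ := hd D a hne hD ha h
        simpa [hdx] using hb ⟨x, hx, rfl⟩
      · exact hbot _⟩

/-- By monotonicity, `f.1 d` bounds from below every value of `f` above `d`. Thus forming the step
function is left adjoint to evaluation at `d`; this gives both algebraicity of function spaces and
Lawson continuity of evaluation. -/
theorem stepFun_le_iff {X Y : Cpo} {d : X} (hd : IsCompactElement d) (e : Y) (f : funCpo X Y) :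
    stepFun hd e ≤ f ↔ e ≤ f.1 d := by
  constructor
  · intro h
    have := (show (stepFun hd e).1 ≤ f.1 from h) d
    simpa [stepFun] using this
  · intro h
    change (stepFun hd e).1 ≤ f.1
    intro x
    dsimp only [stepFun]
    split_ifs with hx
    · exact h.trans (f.2.monotone hx)
    · exact Y.exists_bot.choose_spec _

theorem isCompactElement_stepFun {X Y : Cpo} {d : X} (hd : IsCompactElement d) {e : Y}
    (he : IsCompactElement e) : IsCompactElement (stepFun hd e) := by
  intro D f hne hD hf h
  obtain ⟨_, ⟨g, hg, rfl⟩, hge⟩ := he _ _ (hne.image _)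
    (directedOn_image_of_monotone
      (fun (g g' : funCpo X Y) h => (show g.1 ≤ g'.1 from h) d) hD)
    (fun_isLUB_apply hne hD hf d) ((stepFun_le_iff hd e f).1 h)
  exact ⟨g, hg, (stepFun_le_iff hd e g).2 hge⟩

/-- Every `x` is the directed supremum of the compact elements below it, and `f` preserves that
supremum. -/
theorem IsScottDomain.fun_le {X Y : Cpo} (hX : IsScottDomain X) {f g : X → Y}
    (hf : ScottContinuous f) (hg : Monotone g) (h : ∀ d, IsCompactElement d → f d ≤ g d) (x : X) :
    f x ≤ g x := by
  refine (hf (hX.approx_nonempty x) (hX.approx_directed x) (hX.approx_isLUB x)).2 ?_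
  rintro _ ⟨d, ⟨hd, hdx⟩, rfl⟩
  exact (h d hd).trans (hg hdx)

theorem IsScottDomain.arrow {X Y : Cpo} (hX : IsScottDomain X) (hY : IsScottDomain Y) :
    IsScottDomain (funCpo X Y) := by
  refine IsScottDomain.of_le (fun f g h => ?_) fun f g h hf hg => ?_
  · change f.1 ≤ g.1
    refine hX.fun_le f.2 g.2.monotone fun d hd => hY.le_of_forall fun e he hef => ?_
    exact (stepFun_le_iff hd e g).1
      (h _ (isCompactElement_stepFun hd he) ((stepFun_le_iff hd e f).2 hef))
  -- The pointwise joins, which exist because `h` is a common bound, again form a continuous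
  -- function: joins commute with directed suprema.
  · choose z hz using fun x => hY.exists_lub_of_le
      ((show f.1 ≤ h.1 from hf) x) ((show g.1 ≤ h.1 from hg) x)
    simp only [isLUB_pair_iff] at hz
    have hmono : Monotone z := fun x y hxy => (hz x).2.2 _
      ((f.2.monotone hxy).trans (hz y).1) ((g.2.monotone hxy).trans (hz y).2.1)
    have hcont : ScottContinuous z := by
      intro D hne hD a ha
      refine ⟨hmono.mem_upperBounds_image ha.1, fun b hb => (hz a).2.2 b ?_ ?_⟩
      · refine (f.2 hne hD ha).2 ?_
        rintro _ ⟨x, hx, rfl⟩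
        exact (hz x).1.trans (hb ⟨x, hx, rfl⟩)
      · refine (g.2 hne hD ha).2 ?_
        rintro _ ⟨x, hx, rfl⟩
        exact (hz x).2.1.trans (hb ⟨x, hx, rfl⟩)
    exact ⟨⟨z, hcont⟩, isLUB_pair_iff.2 ⟨fun x => (hz x).1, fun x => (hz x).2.1,
      fun b hb hb' x => (hz x).2.2 _ ((show f.1 ≤ b.1 from hb) x) ((show g.1 ≤ b.1 from hb') x)⟩⟩

/-! ### Bilimits -/

/-- This adjunction reduces comparisons in a bilimit to comparisons at its stages. -/
theorem emb_le_iff {X Y : Cpo} (f : X ⟶ Y) (x : X) (y : Y) :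
    EP.emb f x ≤ y ↔ x ≤ EP.proj f y :=
  ⟨fun h => (EP.proj_emb f x).symm.le.trans ((EP.proj_cont f).monotone h),
    fun h => ((EP.emb_cont f).monotone h).trans (EP.emb_proj f y)⟩

/-- A left adjoint preserves compactness when its right adjoint is Scott-continuous. -/
theorem isCompactElement_emb {X Y : Cpo} (f : X ⟶ Y) {d : X} (hd : IsCompactElement d) :
    IsCompactElement (EP.emb f d) := by
  intro D a hne hD ha h
  obtain ⟨_, ⟨x, hx, rfl⟩, hdx⟩ := hd _ _ (hne.image _)
    (directedOn_image_of_monotone (EP.proj_cont f).monotone hD) (EP.proj_cont f hne hD ha)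
    ((emb_le_iff f _ _).1 h)
  exact ⟨x, hx, (emb_le_iff f _ _).2 hdx⟩

theorem IsScottDomain.lim {K : ℕ → Cpo} {k : ∀ n, K n ⟶ K (n + 1)}
    (hK : ∀ n, IsScottDomain (K n)) : IsScottDomain (limCpo K k) := by
  refine IsScottDomain.of_le (fun x b h n => ?_) fun x y b hx hy => ?_
  · exact (hK n).le_of_forall fun d hd hdx => (emb_le_iff (limIn K k n) d b).1
      (h _ (isCompactElement_emb _ hd) ((emb_le_iff (limIn K k n) d x).2 hdx))
  · have hxb : ∀ n, x.1 n ≤ b.1 n := fun n => hx n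
    have hyb : ∀ n, y.1 n ≤ b.1 n := fun n => hy n
    choose z hz using fun n => (hK n).exists_lub_of_le (hxb n) (hyb n)
    simp only [isLUB_pair_iff] at hz
    -- Projections need not preserve binary joins, so the stagewise joins `z n` need not form a
    -- point of the bilimit. Their embeddings do form an increasing chain, whose supremum is the
    -- required join.
    have hmono : Monotone fun n => EP.emb (limIn K k n) (z n) := by
      refine monotone_nat_of_le_succ fun n => (emb_le_iff (limIn K k n) _ _).2 ?_
      have h : EP.proj (limIn K k n) (EP.emb (limIn K k (n + 1)) (z (n + 1))) =
          EP.proj (k n) (z (n + 1)) := by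
        rw [← limIn_comp, comp_proj, EP.proj_emb]
      rw [h]
      refine (hz n).2.2 _ ?_ ?_
      · rw [← x.2 n]
        exact (EP.proj_cont (k n)).monotone (hz (n + 1)).1
      · rw [← y.2 n]
        exact (EP.proj_cont (k n)).monotone (hz (n + 1)).2.1
    obtain ⟨w, hw⟩ := (limCpo K k).exists_lub _ (Set.range_nonempty _)
      (directedOn_range.2 hmono.directed_le)
    have hzw : ∀ n, z n ≤ w.1 n := fun n => (emb_le_iff (limIn K k n) _ _).1 (hw.1 ⟨n, rfl⟩)
    refine ⟨w, isLUB_pair_iff.2 ⟨fun n => (hz n).1.trans (hzw n),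
      fun n => (hz n).2.1.trans (hzw n), fun c hc hc' => hw.2 ?_⟩⟩
    rintro _ ⟨n, rfl⟩
    exact (emb_le_iff (limIn K k n) _ _).2 ((hz n).2.2 _ (hc n) (hc' n))

-- Induction on type expressions

theorem isScottDomain_chainObj {n : ℕ} (F : Env (n + 1) ⥤ Cpo)
    (hF : ∀ X : Env (n + 1), (∀ i, IsScottDomain (X i)) → IsScottDomain (F.obj X))
    (X : Env n) (hX : ∀ i, IsScottDomain (X i)) : ∀ m, IsScottDomain (chainObj F X m)
  | 0 => isScottDomain_oneCpo
  | m + 1 => hF (Env.cons (chainObj F X m) X) fun i =>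
      Fin.cases (motive := fun i => IsScottDomain (Env.cons (chainObj F X m) X i))
        (isScottDomain_chainObj F hF X hX m) hX i

theorem Ty.isScottDomain_sem : {n : ℕ} → (T : Ty n) → (X : Env n) →
    (∀ i, IsScottDomain (X i)) → IsScottDomain (T.sem.obj X)
  | _, unit, _, _ => isScottDomain_twoCpo
  | _, prod S T, X, hX => (S.isScottDomain_sem X hX).prod (T.isScottDomain_sem X hX)
  | _, arrow S T, X, hX => (S.isScottDomain_sem X hX).arrow (T.isScottDomain_sem X hX)
  | _, sum S T, X, hX => (S.isScottDomain_sem X hX).sum (T.isScottDomain_sem X hX)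
  | _, var i, _, hX => hX i
  | _, recTy T, X, hX => IsScottDomain.lim
      (isScottDomain_chainObj T.sem (fun Y hY => T.isScottDomain_sem Y hY) X hX)

theorem Ty.isScottDomain_dom (T : PureTy) : IsScottDomain T.dom :=
  T.isScottDomain_sem _ fun i => i.elim0

end ScottDomain

/-! ## Local continuity of the interpretation of types -/

section LocalContinuity

/-- A family of embedding-projection pairs is exhausting when the idempotents which it induces on
its codomain have the identity as their pointwise supremum. -/
def Exhausts {K : ℕ → Cpo} {C : Cpo} (t : ∀ m, K m ⟶ C) : Prop :=
  ∀ y b : C, (∀ m, EP.emb (t m) (EP.proj (t m) y) ≤ b) → y ≤ b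

theorem cocone_idempotent_mono {K : ℕ → Cpo} {k : ∀ m, K m ⟶ K (m + 1)} {C : Cpo}
    {t : ∀ m, K m ⟶ C} (ht : ∀ m, k m ≫ t (m + 1) = t m) (y : C) :
    Monotone fun m => EP.emb (t m) (EP.proj (t m) y) :=
  monotone_nat_of_le_succ fun m => by
    rw [← ht m]
    exact (EP.emb_cont (t (m + 1))).monotone (EP.emb_proj (k m) _)

theorem Exhausts.isLUB {K : ℕ → Cpo} {C : Cpo} {t : ∀ m, K m ⟶ C} (h : Exhausts t) (y : C) :
    IsLUB (Set.range fun m => EP.emb (t m) (EP.proj (t m) y)) y := by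
  refine ⟨?_, fun b hb => h y b fun m => hb ⟨m, rfl⟩⟩
  rintro _ ⟨m, rfl⟩
  exact EP.emb_proj _ _

theorem exhausts_limIn (K : ℕ → Cpo) (k : ∀ n, K n ⟶ K (n + 1)) : Exhausts (limIn K k) :=
  fun y b h n => (emb_le_iff (limIn K k n) (y.1 n) b).1 (h n)

/-- The functors which preserve exhausting cocones over countable chains. -/
def LocallyContinuous {n : ℕ} (F : Env n ⥤ Cpo) : Prop :=
  ∀ (X : ℕ → Env n) (k : ∀ m, X m ⟶ X (m + 1)) (C : Env n) (t : ∀ m, X m ⟶ C),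
    (∀ m, k m ≫ t (m + 1) = t m) → (∀ i, Exhausts fun m => t m i) →
      Exhausts fun m => F.map (t m)

variable {n : ℕ} {F G : Env n ⥤ Cpo}

theorem LocallyContinuous.prod (hF : LocallyContinuous F) (hG : LocallyContinuous G) :
    LocallyContinuous (prodF F G) := fun X k C t ht he y b h =>
  ⟨hF X k C t ht he y.1 b.1 fun m => (h m).1, hG X k C t ht he y.2 b.2 fun m => (h m).2⟩

theorem LocallyContinuous.sum (hF : LocallyContinuous F) (hG : LocallyContinuous G) :
    LocallyContinuous (sumF F G) := by
  intro X k C t ht he (y : WithBot (F.obj C ⊕ G.obj C)) (b : WithBot (F.obj C ⊕ G.obj C)) h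
  rcases sum_cases y with rfl | ⟨y, rfl⟩ | ⟨y, rfl⟩
  · exact (bot_le : (⊥ : WithBot (F.obj C ⊕ G.obj C)) ≤ b)
  · obtain ⟨b, rfl⟩ := sumInl_up _ _ (h 0)
    exact (sumInl_le_iff _ _).2 (hF X k C t ht he y b fun m => (sumInl_le_iff _ _).1 (h m))
  · obtain ⟨b, rfl⟩ := sumInr_up _ _ (h 0)
    exact (sumInr_le_iff _ _).2 (hG X k C t ht he y b fun m => (sumInr_le_iff _ _).1 (h m))

theorem map_idempotent_mono (F : Env n ⥤ Cpo) {X : ℕ → Env n} {k : ∀ m, X m ⟶ X (m + 1)} {C : Env n}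
    {t : ∀ m, X m ⟶ C} (ht : ∀ m, k m ≫ t (m + 1) = t m) (y : F.obj C) :
    Monotone fun m => EP.emb (F.map (t m)) (EP.proj (F.map (t m)) y) :=
  cocone_idempotent_mono (K := fun m => F.obj (X m)) (k := fun m => F.map (k m))
    (t := fun m => F.map (t m)) (fun m => by rw [← F.map_comp, ht]) y

/-- The idempotent on a function space truncates both the argument and the value. The argument is
approximated first, using continuity of `φ`, and the value second. -/
theorem LocallyContinuous.arrow (hF : LocallyContinuous F) (hG : LocallyContinuous G) :
    LocallyContinuous (funF F G) := by
  intro X k C t ht he φ b h x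
  have hx := (hF X k C t ht he).isLUB x
  have hmF := map_idempotent_mono F ht x
  refine (φ.2 (Set.range_nonempty _) (directedOn_range.2 hmF.directed_le) hx).2 ?_
  rintro _ ⟨_, ⟨l, rfl⟩, rfl⟩
  refine hG X k C t ht he _ _ fun m => ?_
  -- The two truncation levels `l` and `m` are independent; monotonicity of both families of
  -- idempotents lets `max l m` dominate them.
  refine le_trans ?_ ((show ∀ x, _ ≤ b.1 x from h (max l m)) x)
  refine (map_idempotent_mono G ht _ (le_max_right l m)).trans ?_
  exact (EP.emb_cont _).monotone ((EP.proj_cont _).monotone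
    (φ.2.monotone (hmF (le_max_left l m))))

theorem exhausts_consMap {K : ℕ → Cpo} {A : Cpo} {f : ∀ m, K m ⟶ A} (hf : Exhausts f)
    {X : ℕ → Env n} {C : Env n} {t : ∀ m, X m ⟶ C} (ht : ∀ i, Exhausts fun m => t m i)
    (i : Fin (n + 1)) : Exhausts fun m => consMap (f m) (t m) i := by
  refine Fin.cases ?_ (fun i => ?_) i
  exacts [hf, ht i]

theorem exhausts_chainMap {F : Env (n + 1) ⥤ Cpo} (hF : LocallyContinuous F)
    (X : ℕ → Env n) (k : ∀ m, X m ⟶ X (m + 1)) (C : Env n) (t : ∀ m, X m ⟶ C)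
    (ht : ∀ m, k m ≫ t (m + 1) = t m) (he : ∀ i, Exhausts fun m => t m i) :
    ∀ j, Exhausts fun m => chainMap F (t m) j
  | 0 => fun _ _ _ => le_rfl
  | j + 1 => hF (fun m => Env.cons (chainObj F (X m) j) (X m))
      (fun m => consMap (chainMap F (k m) j) (k m)) (Env.cons (chainObj F C j) C)
      (fun m => consMap (chainMap F (t m) j) (t m))
      (fun m => by rw [← consMap_comp, ← chainMap_comp, ht])
      (exhausts_consMap (exhausts_chainMap hF X k C t ht he j) he)

/-- The order on a bilimit is componentwise, and at each component `j` the maps `chainMap F (t m) j`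
exhaust by induction on `j`. -/
theorem LocallyContinuous.recF {F : Env (n + 1) ⥤ Cpo} (hF : LocallyContinuous F) :
    LocallyContinuous (recF F) := by
  intro X k C t ht he y b h j
  refine exhausts_chainMap hF X k C t ht he j _ _ fun m => ?_
  refine (emb_le_iff (limIn (chainObj F C) (chainStep F C) j) _ b).1 (le_trans ?_ (h m))
  -- The embedding out of a bilimit is a supremum over stages; only its `j`th term is needed.
  exact (descEmb_isLUB (fun j => chainMap F (t m) j ≫ limIn _ (chainStep F C) j)
    (fun j => by rw [← Category.assoc, chainMap_step, Category.assoc, limIn_comp])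
    (EP.proj ((PolarLogic.recF F).map (t m)) y)).1 ⟨j, rfl⟩

theorem Ty.locallyContinuous_sem : {n : ℕ} → (T : Ty n) → LocallyContinuous T.sem
  | _, unit => fun _ _ _ _ _ _ _ _ h => h 0
  | _, prod S T => S.locallyContinuous_sem.prod T.locallyContinuous_sem
  | _, arrow S T => S.locallyContinuous_sem.arrow T.locallyContinuous_sem
  | _, sum S T => S.locallyContinuous_sem.sum T.locallyContinuous_sem
  | _, var i => fun _ _ _ _ _ he => he i
  | _, recTy T => T.locallyContinuous_sem.recF

-- Unfolding is an isomorphism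

/-- The stages exhaust the bilimit, so by local continuity their images under `F` exhaust the
codomain, and these images all factor through the unfolding. -/
theorem unfoldHom_emb_proj {F : Env (n + 1) ⥤ Cpo} (hF : LocallyContinuous F) (X : Env n)
    (y : F.obj (Env.cons ((recF F).obj X) X)) :
    EP.emb (unfoldHom F X) (EP.proj (unfoldHom F X) y) = y := by
  refine le_antisymm (EP.emb_proj _ _) ?_
  refine hF (fun m => Env.cons (chainObj F X m) X) (fun m => consMap (chainStep F X m) (𝟙 X)) _
    (fun m => consMap (limIn (chainObj F X) (chainStep F X) m) (𝟙 X))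
    (fun m => by rw [← consMap_comp, limIn_comp, Category.comp_id])
    (exhausts_consMap (exhausts_limIn _ _) fun i _ _ h => h 0) _ _ fun m => ?_
  -- The image under `F` of stage `m` is member `m + 1` of `unfoldCocone`, because member `0` starts
  -- at the one-point cpo.
  exact (descEmb_isLUB (unfoldCocone F X) (unfoldCocone_comp F X)
    (EP.proj (unfoldHom F X) y)).1 ⟨m + 1, rfl⟩

theorem comp_emb_proj {A B C : Cpo} {f : A ⟶ B} {g : B ⟶ C}
    (hf : ∀ y, EP.emb f (EP.proj f y) = y) (hg : ∀ z, EP.emb g (EP.proj g z) = z) (z : C) :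
    EP.emb (f ≫ g) (EP.proj (f ≫ g) z) = z := by
  rw [comp_emb, comp_proj, hf, hg]

theorem eqToHom_emb_proj {A B : Cpo} (h : A = B) (y : B) :
    EP.emb (eqToHom h) (EP.proj (eqToHom h) y) = y := by
  subst h
  rfl

/-- The inverse of the unfolding map. -/
noncomputable def Ty.refold (T : Ty 1) : dom (T.inst (recTy T)) → dom (recTy T) :=
  EP.proj (unfoldHom T.sem Fin.elim0 ≫ eqToHom (sem_inst_obj T (recTy T) Fin.elim0).symm)

theorem Ty.unfold_refold (T : Ty 1) (y : dom (T.inst (recTy T))) : T.unfold (T.refold y) = y :=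
  comp_emb_proj (unfoldHom_emb_proj T.locallyContinuous_sem _) (eqToHom_emb_proj _) y

theorem Ty.scottContinuous_unfold (T : Ty 1) : ScottContinuous T.unfold := EP.emb_cont _

theorem Ty.scottContinuous_refold (T : Ty 1) : ScottContinuous T.refold := EP.proj_cont _

theorem Ty.refold_unfold (T : Ty 1) (x : dom (recTy T)) : T.refold (T.unfold x) = x :=
  EP.proj_emb _ x

/-- An embedding-projection pair only makes `refold` right adjoint to `unfold`; being an inverse
makes it left adjoint as well, which is the direction needed for inverse images. -/
theorem Ty.le_unfold_iff (T : Ty 1) (x : dom (recTy T)) (y : dom (T.inst (recTy T))) :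
    y ≤ T.unfold x ↔ T.refold y ≤ x := by
  constructor
  · intro h
    simpa only [refold_unfold] using T.scottContinuous_refold.monotone h
  · intro h
    simpa only [unfold_refold] using T.scottContinuous_unfold.monotone h

theorem Ty.isCompactElement_refold (T : Ty 1) {d : dom (T.inst (recTy T))}
    (hd : IsCompactElement d) : IsCompactElement (T.refold d) := by
  intro D a hne hD ha h
  obtain ⟨_, ⟨x, hx, rfl⟩, hdx⟩ := hd _ _ (hne.image _)
    (directedOn_image_of_monotone T.scottContinuous_unfold.monotone hD)
    (T.scottContinuous_unfold hne hD ha) ((T.le_unfold_iff _ _).2 h)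
  exact ⟨x, hx, (T.le_unfold_iff _ _).1 hdx⟩

end LocalContinuity

/-! ## Scott-open sets -/

section ScottOpen

theorem scottOpen_iff {X : Cpo} {U : Set X} :
    ScottOpen X U ↔ IsUpperSet U ∧ DirSupInacc U := by
  let : TopologicalSpace X := Topology.scott X Set.univ
  have : Topology.IsScott X Set.univ := ⟨rfl⟩
  exact (Topology.IsScott.isOpen_iff_isUpperSet_and_dirSupInaccOn (D := Set.univ)).trans
    (by rw [dirSupInaccOn_univ])

theorem ScottOpen.univ (X : Cpo) : ScottOpen X Set.univ :=
  @isOpen_univ X (Topology.scott X Set.univ)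

theorem ScottOpen.empty (X : Cpo) : ScottOpen X ∅ :=
  @isOpen_empty X (Topology.scott X Set.univ)

theorem ScottOpen.inter {X : Cpo} {U V : Set X} (hU : ScottOpen X U) (hV : ScottOpen X V) :
    ScottOpen X (U ∩ V) :=
  @IsOpen.inter X (Topology.scott X Set.univ) U V hU hV

theorem ScottOpen.union {X : Cpo} {U V : Set X} (hU : ScottOpen X U) (hV : ScottOpen X V) :
    ScottOpen X (U ∪ V) :=
  @IsOpen.union X U V (Topology.scott X Set.univ) hU hV

theorem ScottOpen.iUnion {X : Cpo} {U : ℕ → Set X} (hU : ∀ n, ScottOpen X (U n)) :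
    ScottOpen X (⋃ n, U n) :=
  @isOpen_iUnion X ℕ (Topology.scott X Set.univ) U hU

theorem ScottOpen.preimage {X Y : Cpo} {f : X → Y} (hf : ScottContinuous f) {U : Set Y}
    (hU : ScottOpen Y U) : ScottOpen X (f ⁻¹' U) := by
  rw [scottOpen_iff] at hU ⊢
  refine ⟨hU.1.preimage hf.monotone, fun D hne hD a ha haU => ?_⟩
  obtain ⟨_, ⟨x, hx, rfl⟩, hxU⟩ :=
    hU.2 (hne.image f) (directedOn_image_of_monotone hf.monotone hD) (hf hne hD ha) haU
  exact ⟨x, hx, hxU⟩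

theorem scottOpen_Ici {X : Cpo} {d : X} (hd : IsCompactElement d) : ScottOpen X (Set.Ici d) :=
  scottOpen_iff.2 ⟨isUpperSet_Ici d, fun D hne hD a ha hda => hd D a hne hD ha hda⟩

theorem isUpperSet_image_of_up {X S : Cpo} {i : X → S} (hi : ∀ x y, i x ≤ i y ↔ x ≤ y)
    (hup : ∀ x s, i x ≤ s → ∃ y, i y = s) {U : Set X} (hU : IsUpperSet U) :
    IsUpperSet (i '' U) := by
  rintro _ s hs ⟨x, hx, rfl⟩
  obtain ⟨y, rfl⟩ := hup _ _ hs
  exact ⟨y, hU ((hi _ _).1 hs) hx, rfl⟩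

/-- Trades a direct image for an inverse image, for which topological closure properties are
available. -/
theorem image_eq_of_retraction {X S : Cpo} {i : X → S} {p : S → X} (hp : ∀ x, p (i x) = x)
    (hup : ∀ x s, i x ≤ s → ∃ y, i y = s) {b : X} (hib : ∀ x, i b ≤ i x) (U : Set X) :
    i '' U = Set.Ici (i b) ∩ p ⁻¹' U := by
  ext s
  constructor
  · rintro ⟨x, hx, rfl⟩
    exact ⟨hib x, by rwa [Set.mem_preimage, hp]⟩
  · rintro ⟨h, hs⟩
    obtain ⟨y, rfl⟩ := hup _ _ h
    exact ⟨y, by rwa [Set.mem_preimage, hp] at hs, rfl⟩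

end ScottOpen

/-! ## The Lawson topology -/

section Lawson

open scoped Classical in
/-- The Lawson topology of an algebraic cpo: the coarsest topology for which the principal upper
sets of compact elements are open and closed. -/
@[reducible]
noncomputable def lawson (X : Cpo) : TopologicalSpace X :=
  TopologicalSpace.induced (fun (x : X) (d : {d : X // IsCompactElement d}) => decide (d.1 ≤ x))
    inferInstance

theorem isClopen_lawson_Ici {X : Cpo} {d : X} (hd : IsCompactElement d) :
    @IsClopen X (lawson X) (Set.Ici d) := by
  classical
  let := lawson X
  have hι : Continuous fun (x : X) (d : {d : X // IsCompactElement d}) => decide (d.1 ≤ x) :=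
    continuous_induced_dom
  have hc : Continuous fun x : X => decide (d ≤ x) := continuous_pi_iff.1 hι ⟨d, hd⟩
  have h : Set.Ici d = (fun x : X => decide (d ≤ x)) ⁻¹' {true} := by
    ext x
    simp
  rw [h]
  exact (isClopen_discrete _).preimage hc

/-- The Lawson topology on `Y` is induced from a power of a discrete two-point space, so continuity
is tested on one two-valued coordinate for each compact element. -/
theorem continuous_lawson {X Y : Cpo} {f : X → Y}
    (hf : ∀ e : Y, IsCompactElement e → @IsClopen X (lawson X) {x | e ≤ f x}) :
    @Continuous X Y (lawson X) (lawson Y) f := by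
  classical
  let := lawson X
  refine continuous_induced_rng.2 (continuous_pi fun e => ?_)
  refine (IsLocallyConstant.iff_exists_open _).2 (fun x => ?_) |>.continuous
  by_cases h : e.1 ≤ f x
  · exact ⟨{x | e.1 ≤ f x}, (hf e.1 e.2).isOpen, h, fun y hy => by
      simp only [Set.mem_ofPred_eq] at hy
      simp [h, hy]⟩
  · exact ⟨{x | e.1 ≤ f x}ᶜ, (hf e.1 e.2).isClosed.isOpen_compl, h, fun y hy => by
      simp only [Set.mem_compl_iff, Set.mem_ofPred_eq] at hy
      simp [h, hy]⟩

theorem le_nhds_lawson {X : Cpo} {x : X} {f : Filter X}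
    (h : ∀ d, IsCompactElement d → ∀ᶠ y in f, (d ≤ y ↔ d ≤ x)) : f ≤ @nhds X (lawson X) x := by
  classical
  rw [lawson, nhds_induced, ← Filter.tendsto_iff_comap, tendsto_pi_nhds]
  intro d
  rw [nhds_discrete, Filter.tendsto_pure]
  filter_upwards [h d.1 d.2] with y hy
  simp [hy]

/-- The Lawson topology of a Scott domain is compact. -/
theorem IsScottDomain.isCompact_lawson {X : Cpo} (hX : IsScottDomain X) :
    @IsCompact X (lawson X) Set.univ := by
  let := lawson X
  rw [isCompact_iff_ultrafilter_le_nhds]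
  intro f _
  obtain ⟨b, hb⟩ := X.exists_bot
  -- The limit of the ultrafilter is the supremum of the compact elements whose principal upper sets
  -- it contains.
  have hne : {d : X | IsCompactElement d ∧ Set.Ici d ∈ f}.Nonempty :=
    ⟨b, isCompactElement_of_forall_le hb, Filter.mem_of_superset Filter.univ_mem fun x _ => hb x⟩
  have hdir : DirectedOn (· ≤ ·) {d : X | IsCompactElement d ∧ Set.Ici d ∈ f} := by
    rintro d ⟨hd, hdf⟩ e ⟨he, hef⟩
    -- A member of the ultrafilter is nonempty, and any of its points is the bound that bounded
    -- completeness requires.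
    obtain ⟨y, hdy, hey⟩ := f.nonempty_of_mem (Filter.inter_mem hdf hef)
    obtain ⟨z, hz⟩ := hX.exists_lub_of_le hdy hey
    refine ⟨z, ⟨isCompactElement_lub_pair hd he hz, ?_⟩, hz.1 (by simp), hz.1 (by simp)⟩
    refine Filter.mem_of_superset (Filter.inter_mem hdf hef) fun w hw => ?_
    exact (isLUB_pair_iff.1 hz).2.2 w hw.1 hw.2
  obtain ⟨x, hx⟩ := X.exists_lub _ hne hdir
  refine ⟨x, trivial, le_nhds_lawson fun d hd => ?_⟩
  by_cases hdf : Set.Ici d ∈ f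
  · filter_upwards [hdf] with y hy
    exact ⟨fun _ => hx.1 ⟨hd, hdf⟩, fun _ => hy⟩
  · filter_upwards [Ultrafilter.compl_mem_iff_notMem.2 hdf] with y hy
    refine ⟨fun h => (hy h).elim, fun h => ?_⟩
    -- A compact `d` below the supremum is below some `e` of the directed set, which would put
    -- `Set.Ici d` in the ultrafilter.
    obtain ⟨e, ⟨he, hef⟩, hde⟩ := hd _ _ hne hdir hx h
    exact (hdf (Filter.mem_of_superset hef (Set.Ici_subset_Ici.2 hde))).elim

/-- By algebraicity, each point of a Scott-open `U` lies above a compact `d ∈ U`, and `Set.Ici d` is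
then a Lawson-open neighbourhood inside `U`. -/
theorem IsScottDomain.lawson_le_scott {X : Cpo} (hX : IsScottDomain X) :
    lawson X ≤ Topology.scott X Set.univ := by
  intro U hU
  have hU' := scottOpen_iff.1 hU
  let := lawson X
  refine isOpen_iff_mem_nhds.2 fun x hx => ?_
  obtain ⟨d, ⟨hd, hdx⟩, hdU⟩ :=
    hU'.2 (hX.approx_nonempty x) (hX.approx_directed x) (hX.approx_isLUB x) hx
  exact Filter.mem_of_superset ((isClopen_lawson_Ici hd).isOpen.mem_nhds hdx)
    fun y hy => hU'.1 hy hdU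

-- The invariant for negative formulae

/-- The upper sets which are closed for the Lawson topology. -/
def LawsonClosedUpper (X : Cpo) (Q : Set X) : Prop :=
  IsUpperSet Q ∧ @IsClosed X (lawson X) Q

/-- A closed subset of a compact space is compact, and compactness survives passage to a coarser
topology. -/
theorem LawsonClosedUpper.compactSaturated {X : Cpo} (hX : IsScottDomain X) {Q : Set X}
    (hQ : LawsonClosedUpper X Q) : CompactSaturated X Q := by
  refine ⟨?_, hQ.1⟩
  have hQc : @IsCompact X (lawson X) Q := by
    let := lawson X
    exact hX.isCompact_lawson.of_isClosed_subset hQ.2 (Set.subset_univ Q)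
  have := @IsCompact.image X X (lawson X) (Topology.scott X Set.univ) Q id hQc
    (continuous_id_iff_le.2 hX.lawson_le_scott)
  rwa [Set.image_id] at this

theorem LawsonClosedUpper.univ (X : Cpo) : LawsonClosedUpper X Set.univ :=
  ⟨isUpperSet_univ, @isClosed_univ X (lawson X)⟩

theorem LawsonClosedUpper.empty (X : Cpo) : LawsonClosedUpper X ∅ :=
  ⟨isUpperSet_empty, @isClosed_empty X (lawson X)⟩

theorem LawsonClosedUpper.inter {X : Cpo} {P Q : Set X} (hP : LawsonClosedUpper X P)
    (hQ : LawsonClosedUpper X Q) : LawsonClosedUpper X (P ∩ Q) :=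
  ⟨hP.1.inter hQ.1, @IsClosed.inter X P Q (lawson X) hP.2 hQ.2⟩

theorem LawsonClosedUpper.union {X : Cpo} {P Q : Set X} (hP : LawsonClosedUpper X P)
    (hQ : LawsonClosedUpper X Q) : LawsonClosedUpper X (P ∪ Q) :=
  ⟨hP.1.union hQ.1, @IsClosed.union X P Q (lawson X) hP.2 hQ.2⟩

theorem LawsonClosedUpper.iInter {X : Cpo} {ι : Type} {Q : ι → Set X}
    (hQ : ∀ i, LawsonClosedUpper X (Q i)) : LawsonClosedUpper X (⋂ i, Q i) :=
  ⟨isUpperSet_iInter fun i => (hQ i).1, @isClosed_iInter X ι (lawson X) Q fun i => (hQ i).2⟩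

theorem LawsonClosedUpper.Ici {X : Cpo} {d : X} (hd : IsCompactElement d) :
    LawsonClosedUpper X (Set.Ici d) :=
  ⟨isUpperSet_Ici d, @IsClopen.isClosed X (lawson X) _ (isClopen_lawson_Ici hd)⟩

/-- The preimage along a map which has a left adjoint on compact elements. -/
theorem LawsonClosedUpper.preimage {X Y : Cpo} {f : X → Y} (hm : Monotone f)
    (hf : ∀ e : Y, IsCompactElement e → ∃ d : X, IsCompactElement d ∧ ∀ x, e ≤ f x ↔ d ≤ x)
    {Q : Set Y} (hQ : LawsonClosedUpper Y Q) : LawsonClosedUpper X (f ⁻¹' Q) := by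
  refine ⟨hQ.1.preimage hm, ?_⟩
  refine @IsClosed.preimage X Y (lawson X) (lawson Y) f (continuous_lawson fun e he => ?_) Q hQ.2
  obtain ⟨d, hd, hde⟩ := hf e he
  have : {x | e ≤ f x} = Set.Ici d := Set.ext hde
  rw [this]
  exact isClopen_lawson_Ici hd

end Lawson

/-! ## Modalities -/

section Modalities

variable {X Y : Cpo}

theorem scottOpen_pair : ScottOpen twoCpo ({(⊤ : Prop)} : Set Prop) := by
  have : ({(⊤ : Prop)} : Set Prop) = Set.Ici True := by
    ext p
    simp
  rw [this]
  exact scottOpen_Ici (X := twoCpo) isCompactElement_true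

theorem lawsonClosedUpper_pair : LawsonClosedUpper twoCpo ({(⊤ : Prop)} : Set Prop) := by
  have : ({(⊤ : Prop)} : Set Prop) = Set.Ici True := by
    ext p
    simp
  rw [this]
  exact LawsonClosedUpper.Ici (X := twoCpo) isCompactElement_true

theorem lawsonClosedUpper_fst {Q : Set X} (hQ : LawsonClosedUpper X Q) :
    LawsonClosedUpper (prodCpo X Y) {p : X × Y | p.1 ∈ Q} := by
  obtain ⟨b, hb⟩ := Y.exists_bot
  exact hQ.preimage (X := prodCpo X Y) (f := Prod.fst) monotone_fst fun e he =>
    ⟨(e, b), isCompactElement_pair he (isCompactElement_of_forall_le hb),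
      fun p => ⟨fun h => ⟨h, hb _⟩, fun h => h.1⟩⟩

theorem lawsonClosedUpper_snd {Q : Set Y} (hQ : LawsonClosedUpper Y Q) :
    LawsonClosedUpper (prodCpo X Y) {p : X × Y | p.2 ∈ Q} := by
  obtain ⟨b, hb⟩ := X.exists_bot
  exact hQ.preimage (X := prodCpo X Y) (f := Prod.snd) monotone_snd fun e he =>
    ⟨(b, e), isCompactElement_pair (isCompactElement_of_forall_le hb) he,
      fun p => ⟨fun h => ⟨hb _, h⟩, fun h => h.2⟩⟩

theorem scottOpen_image_of_up {X S : Cpo} {i : X → S} (hi : ∀ x y, i x ≤ i y ↔ x ≤ y)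
    (hup : ∀ x s, i x ≤ s → ∃ y, i y = s) (hcpt : ∀ d, IsCompactElement d → IsCompactElement (i d))
    {U : Set X} (hU : ScottOpen X U) : ScottOpen S (i '' U) := by
  obtain ⟨b, hb⟩ := X.exists_bot
  have hb' := hcpt b (isCompactElement_of_forall_le hb)
  rw [scottOpen_iff] at hU ⊢
  refine ⟨isUpperSet_image_of_up hi hup hU.1, ?_⟩
  rintro D hne hD _ ha ⟨x, hx, rfl⟩
  -- The image of the least element is compact, so `D` meets the range of `i`.
  obtain ⟨s, hs, hbs⟩ := hb' D _ hne hD ha ((hi _ _).2 (hb x))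
  obtain ⟨x₀, rfl⟩ := hup _ _ hbs
  have hD' := directedOn_preimage hi hup hD
  obtain ⟨c, hc⟩ := X.exists_lub (i ⁻¹' D) ⟨x₀, hs⟩ hD'
  have hcx := (isLUB_of_preimage hi hup hD hs hc).unique ha
  obtain rfl : c = x := le_antisymm ((hi _ _).1 hcx.le) ((hi _ _).1 hcx.ge)
  obtain ⟨y, hy, hyU⟩ := hU.2 ⟨x₀, hs⟩ hD' hc hx
  exact ⟨i y, hy, y, hyU, rfl⟩

theorem lawsonClosedUpper_image_of_up {X S : Cpo} {i : X → S} (hi : ∀ x y, i x ≤ i y ↔ x ≤ y)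
    (hup : ∀ x s, i x ≤ s → ∃ y, i y = s) (hcpt : ∀ d, IsCompactElement d → IsCompactElement (i d))
    {Q : Set X} (hQ : LawsonClosedUpper X Q) : LawsonClosedUpper S (i '' Q) := by
  classical
  obtain ⟨b, hb⟩ := X.exists_bot
  have hb' := hcpt b (isCompactElement_of_forall_le hb)
  have hinj : Function.Injective i := fun x y h =>
    le_antisymm ((hi _ _).1 h.le) ((hi _ _).1 h.ge)
  refine ⟨isUpperSet_image_of_up hi hup hQ.1, ?_⟩
  -- A retraction of `i` that sends everything outside its range to the least element; it is
  -- Lawson-continuous, so the image is a closed set cut out by `p`.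
  let p : S → X := fun s => if h : ∃ y, i y = s then h.choose else b
  have hp : ∀ x, p (i x) = x := fun x => by
    have h : ∃ y, i y = i x := ⟨x, rfl⟩
    simp only [p, dif_pos h]
    exact hinj h.choose_spec
  have hpc : @Continuous S X (lawson S) (lawson X) p := by
    refine continuous_lawson fun e he => ?_
    -- The default value `b` lies above `e` only when `e = b`, and then the condition is always
    -- true.
    by_cases heb : e = b
    · have : {s | e ≤ p s} = Set.univ := Set.eq_univ_of_forall fun s => heb ▸ hb _
      rw [this]
      exact @isClopen_univ S (lawson S)
    · have : {s | e ≤ p s} = Set.Ici (i e) := by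
        ext s
        constructor
        · intro h
          by_cases hs : ∃ y, i y = s
          · obtain ⟨y, rfl⟩ := hs
            rw [Set.mem_ofPred_eq, hp] at h
            exact (hi _ _).2 h
          · simp only [Set.mem_ofPred_eq, p, dif_neg hs] at h
            exact (heb (le_antisymm h (hb e))).elim
        · intro h
          obtain ⟨y, rfl⟩ := hup _ _ h
          rw [Set.mem_ofPred_eq, hp]
          exact (hi _ _).1 h
      rw [this]
      exact isClopen_lawson_Ici (hcpt e he)
  rw [image_eq_of_retraction hp hup (fun x => (hi _ _).2 (hb x)) Q]
  exact @IsClosed.inter S _ _ (lawson S) (LawsonClosedUpper.Ici hb').2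
    (@IsClosed.preimage S X (lawson S) (lawson X) p hpc Q hQ.2)

/-- If the supremum of a directed set of functions maps `Q` into `U`, the inverse images of `U`
under its members form a directed open cover of `Q`. Compactness selects a single member. -/
theorem scottOpen_arrow {Q : Set X} (hQ : ScottCompact X Q) {U : Set Y} (hU : ScottOpen Y U) :
    ScottOpen (funCpo X Y) {f : {f : X → Y // ScottContinuous f} | ∀ x ∈ Q, f.1 x ∈ U} := by
  have hU' := scottOpen_iff.1 hU
  refine scottOpen_iff.2 ⟨fun f g hfg hf x hx =>
    hU'.1 ((show f.1 ≤ g.1 from hfg) x) (hf x hx), fun D hne hD f hf hfU => ?_⟩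
  let : TopologicalSpace X := Topology.scott X Set.univ
  have : Nonempty D := hne.to_subtype
  have hcov : Q ⊆ ⋃ g : D, g.1.1 ⁻¹' U := by
    intro x hx
    obtain ⟨_, ⟨g, hg, rfl⟩, hgU⟩ := hU'.2 (hne.image _)
      (directedOn_image_of_monotone
        (fun (g g' : funCpo X Y) h => (show g.1 ≤ g'.1 from h) x) hD)
      (fun_isLUB_apply hne hD hf x) (hfU x hx)
    exact Set.mem_iUnion.2 ⟨⟨g, hg⟩, hgU⟩
  have hdir : Directed (· ⊆ ·) fun g : D => g.1.1 ⁻¹' U := by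
    rintro ⟨g, hg⟩ ⟨g', hg'⟩
    obtain ⟨w, hw, h, h'⟩ := hD g hg g' hg'
    exact ⟨⟨w, hw⟩, fun x hx => hU'.1 ((show g.1 ≤ w.1 from h) x) hx,
      fun x hx => hU'.1 ((show g'.1 ≤ w.1 from h') x) hx⟩
  obtain ⟨g, hg⟩ := IsCompact.elim_directed_cover (show IsCompact Q from hQ) _
    (fun g : D => ScottOpen.preimage g.1.2 hU) hcov hdir
  exact ⟨g.1, g.2, fun x hx => hg hx⟩

/-- Every point of the open set `U` lies above a compact element of `U`, and `Q` is an upper set, so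
the condition need only be tested at compact `d ∈ U`. Evaluation at such `d` has step functions as
left adjoint. -/
theorem lawsonClosedUpper_arrow (hX : IsScottDomain X) {U : Set X} (hU : ScottOpen X U) {Q : Set Y}
    (hQ : LawsonClosedUpper Y Q) :
    LawsonClosedUpper (funCpo X Y)
      {f : {f : X → Y // ScottContinuous f} | ∀ x ∈ U, f.1 x ∈ Q} := by
  have h : {f : funCpo X Y | ∀ x ∈ U, f.1 x ∈ Q} =
      ⋂ d : {d : X // IsCompactElement d ∧ d ∈ U}, (fun f : funCpo X Y => f.1 d.1) ⁻¹' Q := by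
    ext f
    rw [Set.mem_iInter]
    refine ⟨fun hf d => hf d.1 d.2.2, fun hf x hx => ?_⟩
    obtain ⟨d, ⟨hd, hdx⟩, hdU⟩ := (scottOpen_iff.1 hU).2 (hX.approx_nonempty x)
      (hX.approx_directed x) (hX.approx_isLUB x) hx
    exact hQ.1 (f.2.monotone hdx) (hf ⟨d, hd, hdU⟩)
  change LawsonClosedUpper (funCpo X Y) {f : funCpo X Y | ∀ x ∈ U, f.1 x ∈ Q}
  rw [h]
  exact LawsonClosedUpper.iInter (X := funCpo X Y) fun d => hQ.preimage
    (fun (f g : funCpo X Y) h => (show f.1 ≤ g.1 from h) d.1) fun e he =>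
      ⟨stepFun d.2.1 e, isCompactElement_stepFun d.2.1 he, fun f => (stepFun_le_iff _ _ _).symm⟩

theorem lawsonClosedUpper_unfold (T : Ty 1) {Q : Set (T.inst (Ty.recTy T)).dom}
    (hQ : LawsonClosedUpper _ Q) : LawsonClosedUpper (Ty.recTy T).dom (T.unfold ⁻¹' Q) :=
  hQ.preimage T.scottContinuous_unfold.monotone fun e he =>
    ⟨T.refold e, T.isCompactElement_refold he, fun x => T.le_unfold_iff x e⟩

end Modalities

/-! ## Polarised formulae -/

section Formulae

/-- Only the quantifier rules constrain the sign, and neither allows the neutral one. The sign is a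
variable with an equation so that induction on the derivation applies. -/
theorem Lang.of_neutral {s' : Sign} {Γ : Ctx} {T : PureTy} {φ : Form Γ T}
    (h : Lang s' φ) (hs : s' = Sign.neutral) (s : Sign) : Lang s φ := by
  induction h generalizing s with
  | tt => exact .tt
  | ff => exact .ff
  | and _ _ h₁ h₂ => exact .and (h₁ hs s) (h₂ hs s)
  | or _ _ h₁ h₂ => exact .or (h₁ hs s) (h₂ hs s)
  | pair => exact .pair
  | fst _ h => exact .fst (h hs s)
  | snd _ h => exact .snd (h hs s)
  | inl _ h => exact .inl (h hs s)
  | inr _ h => exact .inr (h hs s)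
  | fold _ h => exact .fold (h hs s)
  | fpvar x => exact .fpvar x
  | mu _ h => exact .mu (h hs s)
  | nu _ h => exact .nu (h hs s)
  | ex => cases hs
  | all => cases hs
  | realto _ _ h₁ h₂ =>
    -- The opposite of the neutral sign is again neutral, so the induction hypothesis for the
    -- premise applies too.
    subst hs
    exact .realto (h₁ rfl s.opp) (h₂ rfl s)

theorem iterate_induction {α : Type} {p : α → Prop} {f : α → α} {a : α} (ha : p a)
    (hf : ∀ x, p x → p (f x)) : ∀ n, p (f^[n] a)
  | 0 => ha
  | n + 1 => by
    rw [Function.iterate_succ_apply']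
    exact hf _ (iterate_induction ha hf n)

theorem FPVal.forall_cons {p : ∀ T : PureTy, Set T.dom → Prop} {Γ : Ctx} {S : PureTy}
    {P : Set S.dom} {v : FPVal Γ} (hP : p S P) (hv : ∀ T x, p T (v T x)) :
    ∀ T x, p T (FPVal.cons P v T x)
  | _, .here => hP
  | _, .there x => hv _ x

/-- Positive formulae denote Scott-open sets, and negative formulae Lawson-closed upper sets. -/
theorem Form.sem_polarity {Γ : Ctx} {T : PureTy} (φ : Form Γ T) (v : FPVal Γ) (r : ℕ → ℕ) :
    (Lang Sign.pos φ → (∀ S x, ScottOpen S.dom (v S x)) → ScottOpen T.dom (φ.sem v r)) ∧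
    (Lang Sign.neg φ → (∀ S x, LawsonClosedUpper S.dom (v S x)) →
      LawsonClosedUpper T.dom (φ.sem v r)) := by
  -- Both polarities are proved together because implication swaps them, and `r` varies because
  -- quantifiers update it.
  induction φ generalizing r with
  | tt => exact ⟨fun _ _ => .univ _, fun _ _ => .univ _⟩
  | ff => exact ⟨fun _ _ => .empty _, fun _ _ => .empty _⟩
  | and φ ψ h₁ h₂ =>
    constructor <;> rintro ⟨⟩ hv
    · exact ((h₁ v r).1 ‹_› hv).inter ((h₂ v r).1 ‹_› hv)
    · exact ((h₁ v r).2 ‹_› hv).inter ((h₂ v r).2 ‹_› hv)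
  | or φ ψ h₁ h₂ =>
    constructor <;> rintro ⟨⟩ hv
    · exact ((h₁ v r).1 ‹_› hv).union ((h₂ v r).1 ‹_› hv)
    · exact ((h₁ v r).2 ‹_› hv).union ((h₂ v r).2 ‹_› hv)
  | pair => exact ⟨fun _ _ => scottOpen_pair, fun _ _ => lawsonClosedUpper_pair⟩
  | fst φ h =>
    constructor <;> rintro ⟨⟩ hv
    · exact ((h v r).1 ‹_› hv).preimage (X := prodCpo _ _) ScottContinuous.fst
    · exact lawsonClosedUpper_fst ((h v r).2 ‹_› hv)
  | snd φ h =>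
    constructor <;> rintro ⟨⟩ hv
    · exact ((h v r).1 ‹_› hv).preimage (X := prodCpo _ _) ScottContinuous.snd
    · exact lawsonClosedUpper_snd ((h v r).2 ‹_› hv)
  | inl φ h =>
    constructor <;> rintro ⟨⟩ hv
    · exact scottOpen_image_of_up (S := sumCpo _ _) sumInl_le_iff sumInl_up
        (fun _ => isCompactElement_sumInl) ((h v r).1 ‹_› hv)
    · exact lawsonClosedUpper_image_of_up (S := sumCpo _ _) sumInl_le_iff sumInl_up
        (fun _ => isCompactElement_sumInl) ((h v r).2 ‹_› hv)
  | inr φ h =>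
    constructor <;> rintro ⟨⟩ hv
    · exact scottOpen_image_of_up (S := sumCpo _ _) sumInr_le_iff sumInr_up
        (fun _ => isCompactElement_sumInr) ((h v r).1 ‹_› hv)
    · exact lawsonClosedUpper_image_of_up (S := sumCpo _ _) sumInr_le_iff sumInr_up
        (fun _ => isCompactElement_sumInr) ((h v r).2 ‹_› hv)
  | fold φ h =>
    constructor <;> rintro ⟨⟩ hv
    · exact ((h v r).1 ‹_› hv).preimage (Ty.scottContinuous_unfold _)
    · exact lawsonClosedUpper_unfold _ ((h v r).2 ‹_› hv)
  | fpvar x => exact ⟨fun _ hv => hv _ x, fun _ hv => hv _ x⟩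
  | mu t φ h =>
    constructor <;> rintro ⟨⟩ hv
    · exact iterate_induction (.empty _)
        (fun P hP => (h (FPVal.cons P v) r).1 ‹_› (FPVal.forall_cons hP hv)) _
    · exact iterate_induction (.empty _)
        (fun P hP => (h (FPVal.cons P v) r).2 ‹_› (FPVal.forall_cons hP hv)) _
  | nu t φ h =>
    constructor <;> rintro ⟨⟩ hv
    · exact iterate_induction (.univ _)
        (fun P hP => (h (FPVal.cons P v) r).1 ‹_› (FPVal.forall_cons hP hv)) _
    · exact iterate_induction (.univ _)
        (fun P hP => (h (FPVal.cons P v) r).2 ‹_› (FPVal.forall_cons hP hv)) _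
  | ex i φ h =>
    constructor <;> rintro ⟨⟩ hv
    -- Only the positive case survives: no rule gives an existential formula negative polarity.
    -- Universal formulae behave dually.
    exact .iUnion fun n => (h v _).1 ‹_› hv
  | all i φ h =>
    constructor <;> rintro ⟨⟩ hv
    exact .iInter fun n => (h v _).2 ‹_› hv
  | realto ψ φ h₁ h₂ =>
    constructor <;> rintro ⟨⟩ hv
    -- Here Lawson compactness enters the induction: the negative premise denotes a Scott-compact
    -- set because its type is a Scott domain.
    · exact scottOpen_arrow
        (((h₁ FPVal.nil r).2 ‹_› nofun).compactSaturated (Ty.isScottDomain_dom _)).1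
        ((h₂ FPVal.nil r).1 ‹_› nofun)
    · exact lawsonClosedUpper_arrow (Ty.isScottDomain_dom _)
        ((h₁ FPVal.nil r).1 ‹_› nofun) ((h₂ FPVal.nil r).2 ‹_› nofun)

end Formulae
end PolarLogic

-- Formulae without free fixpoint variables

theorem mainTheorem7 (T : PolarLogic.PureTy) :
    PolarLogic.IsScottDomain T.dom ∧
    ∀ (φ : PolarLogic.Form [] T) (v : PolarLogic.FPVal []) (r : ℕ → ℕ),
      (PolarLogic.Lang PolarLogic.Sign.pos φ → PolarLogic.ScottOpen T.dom (φ.sem v r)) ∧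
      (PolarLogic.Lang PolarLogic.Sign.neg φ → PolarLogic.CompactSaturated T.dom (φ.sem v r)) ∧
      (PolarLogic.Lang PolarLogic.Sign.neutral φ →
        PolarLogic.CompactOpen T.dom (φ.sem v r)) := by
  have hT := PolarLogic.Ty.isScottDomain_dom T
  refine ⟨hT, fun φ v r => ?_⟩
  -- The empty context has no fixpoint variables, so the condition on `v` is vacuous.
  have hpos := fun h => (φ.sem_polarity v r).1 h nofun
  have hneg := fun h => ((φ.sem_polarity v r).2 h nofun).compactSaturated hT
  exact ⟨hpos, hneg, fun h => ⟨(hneg (h.of_neutral rfl _)).1, hpos (h.of_neutral rfl _)⟩⟩
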